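/- Let $K$ be a non-Archimedean local field with normalized absolute value $|\cdot|$ and residue field of cardinality $q$, let $\chi$ be an additive character of $K$ of rank zero ($\chi=1$ on $O=\{|x|\le 1\}$, $\chi(x_0)\neq 1$ for some $|x_0|=q$), let $n\ge 1$, $\alpha>0$, and $\|x\|=\max_j|x_j|$ on $K^n$. Haar measures are normalized by $|O|=|O^n|=1$, and $(\mathcal F f)(\xi)=\int\chi(x\cdot\xi)f(x)\,dx$. Let $\mathcal D(K^m)$ be the space of locally constant, compactly supported functions $K^m\to\mathbb C$, let $\Phi(K^m)=\{\varphi\in\mathcal D(K^m):\int\varphi=0\}$, and let $\Phi'(K^m)$ be its dual. Let $\Phi'(K,\Phi'(K^n))$ be the set of distributions over $\Phi(K)$ with values in $\Phi'(K^n)$. For $\gamma\ge 0$ set $D^{\gamma}\varphi=\mathcal F^{-1}(|\xi|^\gamma\mathcal F\varphi)$ on $K$ (so $D^0$ is the identity), and set $D^{\alpha,n}\varphi=\mathcal F^{-1}(\|\xi\|^\alpha\mathcal F\varphi)$ on $K^n$; $D^\alpha$ and $D^{\alpha,n}$ map $\Phi(K)$, respectively $\Phi(K^n)$, into itself. Theorem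 2. Let $F\in\Phi'(K,\Phi'(K^n))$ be a generalized solution of $D_t^\alpha F-D_x^{\alpha,n}F=0$, that is, $$\langle\langle F,D^\alpha\varphi_1\rangle,\varphi_2\rangle=\langle\langle F,\varphi_1\rangle,D^{\alpha,n}\varphi_2\rangle\quad\text{for all }\varphi_1\in\Phi(K),\ \varphi_2\in\Phi(K^n),$$ and let $F$ be radial in $t$, that is, $\langle F,\varphi_1(\omega\,\cdot)\rangle=\langle F,\varphi_1\rangle$ for all $\varphi_1\in\Phi(K)$ and $|\omega|=1$. Then $F\in\mathcal D(K,\Phi'(K^n))$: there is a unique function $t\mapsto F(t,\cdot)\in\Phi'(K^n)$ on $K$ such that $t\mapsto\langle F(t,\cdot),\varphi_2\rangle$ belongs to $\mathcal D(K)$ for every $\varphi_2\in\Phi(K^n)$ and $$\langle\langle F,\varphi_1\rangle,\varphi_2\rangle=\int_K\langle F(t,\cdot),\varphi_2\rangle\varphi_1(t)\,dt\quad\text{for all }\varphi_1\in\Phi(K),\ \varphi_2\in\Phi(K^n).$$ If, in addition, $F(0,\cdot)=0$, or $(D_t^{n-1}F)(0,\cdot)=0$ (that is, $D_t^{n-1}\langle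 F(t,\cdot),\varphi_2\rangle|_{t=0}=0$ for all $\varphi_2\in\Phi(K^n)$), then $F\equiv 0$. Consequently, two generalized solutions $F,G$ that are radial in $t$ and satisfy $F(0,\cdot)=G(0,\cdot)$ or $(D_t^{n-1}F)(0,\cdot)=(D_t^{n-1}G)(0,\cdot)$ coincide. -/

import Mathlib

open MeasureTheory

noncomputable section

set_option linter.unusedSectionVars false

namespace LocalFieldWave

/-! ### Local fields

A non-Archimedean local field is a nontrivially normed field `K` with `IsUltrametricDist K` and
`ProperSpace K` (the latter says that `K` is locally compact); the norm is the absolute value. -/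

/-- The cardinality `q` of the residue field `O / P`, where `O = {x | ‖x‖ ≤ 1}` and
`P = {x | ‖x‖ < 1}`. -/
def residueCard (K : Type*) [NontriviallyNormedField K] [IsUltrametricDist K] : ℕ :=
  Nat.card (IsLocalRing.ResidueField (NormedField.valuation (K := K)).valuationSubring)

/-- The absolute value of the local field `K` is normalized: `P = β O` for some `β` with
`|β| = q⁻¹`. -/
def IsNormalizedAbs (K : Type*) [NontriviallyNormedField K] [IsUltrametricDist K] : Prop :=
  ∃ β : K, ‖β‖ = (residueCard K : ℝ)⁻¹ ∧ ∀ x : K, ‖x‖ < 1 ↔ ∃ y : K, ‖y‖ ≤ 1 ∧ x = β * y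

/-- An additive character `χ` of rank zero: `χ = 1` on `O`, and `χ x₀ ≠ 1` for some `x₀` with
`|x₀| = q`. (Such a character is automatically continuous.) -/
structure IsRankZero {K : Type*} [NontriviallyNormedField K] [IsUltrametricDist K]
    (χ : AddChar K Circle) : Prop where
  eq_one : ∀ x : K, ‖x‖ ≤ 1 → χ x = 1
  ne_one : ∃ x₀ : K, ‖x₀‖ = residueCard K ∧ χ x₀ ≠ 1

/-! ### Haar measure and test functions

Here `E` will be `K` or `Kⁿ = (Fin n → K)`; the norm of the latter is `‖x‖ = maxⱼ |xⱼ|`. -/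

theorem continuous_of_uniform {E : Type*} [NormedAddCommGroup E] {f : E → ℂ}
    (h : ∃ δ > 0, ∀ x x' : E, ‖x'‖ ≤ δ → f (x + x') = f x) : Continuous f := by
  obtain ⟨δ, hδ, h⟩ := h
  refine continuous_iff_continuousAt.2 fun x => ?_
  refine ContinuousAt.congr (f := fun _ => f x) continuousAt_const ?_
  filter_upwards [Metric.ball_mem_nhds x hδ] with y hy
  have := h x (y - x) (by rw [← dist_eq_norm]; exact (Metric.mem_ball.1 hy).le)
  simpa using this.symm

/-- The Bruhat–Schwartz space `𝓓(E)`: locally constant functions (with a uniform exponent of local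
constancy) of compact support. -/
def bruhatSchwartz (E : Type*) [NormedAddCommGroup E] : Submodule ℂ (E → ℂ) where
  carrier := {f | (∃ δ > 0, ∀ x x' : E, ‖x'‖ ≤ δ → f (x + x') = f x) ∧ HasCompactSupport f}
  zero_mem' := ⟨⟨1, one_pos, fun _ _ _ => rfl⟩, HasCompactSupport.zero⟩
  add_mem' := by
    rintro f g ⟨⟨δ, hδ, hf⟩, hf'⟩ ⟨⟨ε, hε, hg⟩, hg'⟩
    refine ⟨⟨min δ ε, lt_min hδ hε, fun x x' h => ?_⟩, hf'.add hg'⟩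
    simp [hf x x' (h.trans (min_le_left _ _)), hg x x' (h.trans (min_le_right _ _))]
  smul_mem' := by
    rintro c f ⟨⟨δ, hδ, hf⟩, hf'⟩
    exact ⟨⟨δ, hδ, fun x x' h => by simp [hf x x' h]⟩, hf'.mono fun x hx h => hx (by simp [h])⟩

theorem bruhatSchwartz_continuous {E : Type*} [NormedAddCommGroup E] {f : E → ℂ} (hf : f ∈ bruhatSchwartz E) : Continuous f :=
  continuous_of_uniform hf.1

section TestFunctions

variable (E : Type*) [NormedAddCommGroup E] [ProperSpace E] [MeasurableSpace E] [BorelSpace E]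

/-- The closed unit ball (`O`, respectively `Oⁿ`). -/
def unitBall : TopologicalSpace.PositiveCompacts E where
  carrier := Metric.closedBall 0 1
  isCompact' := isCompact_closedBall 0 1
  interior_nonempty' :=
    ⟨0, Metric.ball_subset_interior_closedBall (Metric.mem_ball_self one_pos)⟩

/-- The Haar measure for which the closed unit ball has measure `1`. -/
def haar : Measure E := Measure.addHaarMeasure (unitBall E)

instance : (haar E).IsAddHaarMeasure := by unfold haar; infer_instance

variable {E} in
theorem bruhatSchwartz_integrable {f : E → ℂ} (hf : f ∈ bruhatSchwartz E) :
    Integrable f (haar E) :=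
  (bruhatSchwartz_continuous hf).integrable_of_hasCompactSupport hf.2

/-- The Lizorkin space `Φ(E)` of test functions of the second kind: the `φ ∈ 𝓓(E)` with
`∫ φ = 0`. -/
def lizorkin : Submodule ℂ (E → ℂ) where
  carrier := {f | f ∈ bruhatSchwartz E ∧ ∫ x, f x ∂(haar E) = 0}
  zero_mem' := ⟨Submodule.zero_mem _, by simp⟩
  add_mem' := by
    rintro f g ⟨hf, hf'⟩ ⟨hg, hg'⟩
    refine ⟨Submodule.add_mem _ hf hg, ?_⟩
    simp only [Pi.add_apply]
    rw [integral_add (bruhatSchwartz_integrable hf) (bruhatSchwartz_integrable hg), hf', hg',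
      add_zero]
  smul_mem' := by
    rintro c f ⟨hf, hf'⟩
    refine ⟨Submodule.smul_mem _ c hf, ?_⟩
    simp only [Pi.smul_apply]
    rw [integral_smul, hf', smul_zero]

/-- The space `Φ'(E)` of Lizorkin distributions of the second kind. `Φ(E)` carries the topology of
an inductive limit of an increasing sequence of finite-dimensional spaces, in which every linear
functional (indeed every linear map into a topological vector space) is continuous; so the dual is
the space of all linear functionals. -/
abbrev LizorkinDistribution : Type _ := Module.Dual ℂ (lizorkin E)

end TestFunctions

/-! ### Fourier transform and fractional differentiation -/

section Fourier

variable {K : Type*} [NontriviallyNormedField K] [IsUltrametricDist K]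
variable {E : Type*} [NormedAddCommGroup E] [ProperSpace E] [MeasurableSpace E] [BorelSpace E]

/-- `f ↦ ∫ χ(x · ξ) f(x) dx`, for the pairing `x · ξ = B x ξ`. -/
def fourier (χ : AddChar K Circle) (B : E → E → K) (f : E → ℂ) (ξ : E) : ℂ :=
  ∫ x, (χ (B x ξ) : ℂ) * f x ∂(haar E)

/-- `g ↦ ∫ χ(- x · ξ) g(ξ) dξ`, for the pairing `x · ξ = B x ξ`. -/
def fourierInv (χ : AddChar K Circle) (B : E → E → K) (g : E → ℂ) (x : E) : ℂ :=
  ∫ ξ, (χ (-(B x ξ)) : ℂ) * g ξ ∂(haar E)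

/-- The pseudo-differential operator with symbol `‖ξ‖ ^ α`:
`φ ↦ 𝓕⁻¹ (‖ξ‖ ^ α (𝓕 φ)(ξ))`. Note `0 ^ 0 = 1`, so it is the identity on `𝓓(E)` for `α = 0`. -/
def fracDeriv (χ : AddChar K Circle) (B : E → E → K) (α : ℝ) (φ : E → ℂ) : E → ℂ :=
  fourierInv χ B fun ξ => ((‖ξ‖ ^ α : ℝ) : ℂ) * fourier χ B φ ξ

/-- The properties of the pairings of `K` and `Kⁿ` that are needed to show that fractional
differentiation preserves the Lizorkin space; both pairings are proved to have them below. -/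
structure GoodPairing (χ : AddChar K Circle) (B : E → E → K) : Prop where
  cont : Continuous fun p : E × E => B p.1 p.2
  symm : ∀ x ξ, B x ξ = B ξ x
  add_left : ∀ x y ξ, B (x + y) ξ = B x ξ + B y ξ
  norm_le : ∀ x ξ, ‖B x ξ‖ ≤ ‖x‖ * ‖ξ‖
  nondeg : ∃ C > 0, ∀ ξ, ξ ≠ 0 → ∃ x, ‖x‖ * ‖ξ‖ ≤ C ∧ χ (B x ξ) ≠ 1

theorem GoodPairing.neg_left {χ : AddChar K Circle} {B : E → E → K} (hB : GoodPairing χ B)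
    (x ξ : E) : B (-x) ξ = -B x ξ := by
  have h0 : B 0 ξ = 0 := by simpa using hB.add_left 0 0 ξ
  have := hB.add_left (-x) x ξ
  rw [neg_add_cancel, h0] at this
  exact eq_neg_of_add_eq_zero_left this.symm

theorem fourierInv_eq {χ : AddChar K Circle} {B : E → E → K} (hB : GoodPairing χ B)
    (g : E → ℂ) (x : E) : fourierInv χ B g x = fourier χ B g (-x) := by
  unfold fourier fourierInv
  congr 1; ext ξ
  rw [hB.symm ξ (-x), hB.neg_left]

theorem IsRankZero.continuous {χ : AddChar K Circle} (hχ : IsRankZero χ) :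
    Continuous fun x => (χ x : ℂ) :=
  continuous_of_uniform ⟨1, one_pos, fun x x' h => by
    rw [AddChar.map_add_eq_mul, hχ.eq_one x' h, mul_one]⟩

/-- The Fourier transform maps `𝓓(E)` to itself. -/
theorem fourier_mem {χ : AddChar K Circle} (hχ : IsRankZero χ) {B : E → E → K}
    (hB : GoodPairing χ B) {f : E → ℂ} (hf : f ∈ bruhatSchwartz E) :
    fourier χ B f ∈ bruhatSchwartz E := by
  obtain ⟨⟨δ, hδ, hloc⟩, hsupp⟩ := id hf
  constructor
  · obtain ⟨R, hR⟩ := hsupp.isCompact.isBounded.subset_closedBall 0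
    have hR' : ∀ x, f x ≠ 0 → ‖x‖ ≤ |R| + 1 := fun x hx => by
      have := hR (subset_tsupport f hx)
      rw [mem_closedBall_zero_iff] at this
      linarith [le_abs_self R]
    have hpos : 0 < |R| + 1 := by positivity
    refine ⟨(|R| + 1)⁻¹, by positivity, fun ξ ξ' h => ?_⟩
    unfold fourier
    congr 1; ext x
    by_cases hx : f x = 0
    · simp [hx]
    have : χ (B x ξ') = 1 := hχ.eq_one _ <| (hB.norm_le _ _).trans <| by
      calc ‖x‖ * ‖ξ'‖ ≤ (|R| + 1) * (|R| + 1)⁻¹ := by gcongr; exact hR' x hx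
        _ = 1 := mul_inv_cancel₀ hpos.ne'
    rw [hB.symm x, hB.add_left, hB.symm ξ, hB.symm ξ', AddChar.map_add_eq_mul, this, mul_one]
  · obtain ⟨C, hC, hnd⟩ := hB.nondeg
    refine HasCompactSupport.intro (isCompact_closedBall (0 : E) (C / δ)) fun ξ hξ => ?_
    rw [mem_closedBall_zero_iff, not_le] at hξ
    have hξ0 : 0 < ‖ξ‖ := (by positivity : 0 < C / δ).trans hξ
    obtain ⟨y, hy, hy1⟩ := hnd ξ (norm_pos_iff.1 hξ0)
    have hyδ : ‖y‖ ≤ δ := by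
      rw [div_lt_iff₀ hδ] at hξ
      by_contra! h
      nlinarith
    have key : fourier χ B f ξ = (χ (B y ξ) : ℂ) * fourier χ B f ξ := by
      conv_lhs => unfold fourier
      rw [← integral_add_right_eq_self _ y]
      unfold fourier
      rw [← integral_const_mul]
      congr 1; ext x
      rw [hloc x y hyδ, hB.add_left, AddChar.map_add_eq_mul, Circle.coe_mul]
      ring
    have h1 : (χ (B y ξ) : ℂ) ≠ 1 := fun h => hy1 (by ext; simpa using h)
    have h2 : (1 - (χ (B y ξ) : ℂ)) * fourier χ B f ξ = 0 := by linear_combination key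
    exact (mul_eq_zero.1 h2).resolve_left (sub_ne_zero.2 h1.symm)

/-- `∫ 𝓕 g = 0` if `g ∈ 𝓓(E)` and `g 0 = 0`. -/
theorem integral_fourier_eq_zero [IsUltrametricDist E] {χ : AddChar K Circle} (hχ : IsRankZero χ)
    {B : E → E → K} (hB : GoodPairing χ B) {g : E → ℂ} (hg : g ∈ bruhatSchwartz E)
    (h0 : g 0 = 0) : ∫ x, fourier χ B g x ∂(haar E) = 0 := by
  obtain ⟨⟨δ, hδ, hloc⟩, hsupp⟩ := id hg
  obtain ⟨R₀, hR₀⟩ := (fourier_mem hχ hB hg).2.isCompact.isBounded.subset_closedBall 0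
  obtain ⟨C, hC, hnd⟩ := hB.nondeg
  obtain ⟨R, hR, hRC⟩ : ∃ R > 0, R₀ ≤ R ∧ C ≤ R * δ :=
    ⟨max (|R₀| + 1) (C / δ), by positivity,
      (le_abs_self R₀).trans ((le_add_of_nonneg_right one_pos.le).trans (le_max_left _ _)),
      (div_le_iff₀ hδ).1 (le_max_right _ _)⟩
  set S : Set E := Metric.closedBall 0 R with hS
  let F : E → E → ℂ := fun x ξ => S.indicator (fun _ => (1 : ℂ)) x * ((χ (B ξ x) : ℂ) * g ξ)
  have hScl : IsClopen S := IsUltrametricDist.isClopen_closedBall _ hR.ne'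
  have hind : Continuous (S.indicator fun _ => (1 : ℂ)) :=
    (IsLocallyConstant.const (1 : ℂ)).continuous.indicator (by simp [hScl.frontier_eq])
  have hFc : Continuous F.uncurry := by
    have h1 : Continuous fun p : E × E => (χ (B p.2 p.1) : ℂ) :=
      hχ.continuous.comp (hB.cont.comp continuous_swap)
    exact (hind.comp continuous_fst).mul (h1.mul
      ((bruhatSchwartz_continuous hg).comp continuous_snd))
  have hFs : HasCompactSupport F.uncurry := by
    refine HasCompactSupport.intro ((isCompact_closedBall (0 : E) R).prod hsupp.isCompact) ?_
    rintro ⟨x, ξ⟩ h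
    by_cases hx : x ∈ S
    · have : ξ ∉ tsupport g := fun h' => h ⟨hx, h'⟩
      simp [F, Function.uncurry, image_eq_zero_of_notMem_tsupport this]
    · simp [F, Function.uncurry, hx]
  have e1 : ∀ x, fourier χ B g x = ∫ ξ, F x ξ ∂(haar E) := fun x => by
    simp only [F]
    rw [integral_const_mul]
    by_cases hx : x ∈ S
    · simp [hx, fourier]
    · have : x ∉ tsupport (fourier χ B g) := fun h' =>
        hx (Metric.closedBall_subset_closedBall hRC.1 (hR₀ h'))
      simp [hx, image_eq_zero_of_notMem_tsupport this]
  simp_rw [e1]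
  rw [integral_integral_swap_of_hasCompactSupport hFc hFs]
  refine integral_eq_zero_of_ae (Filter.Eventually.of_forall fun ξ => ?_)
  show ∫ x, F x ξ ∂(haar E) = 0
  by_cases hξ : ‖ξ‖ ≤ δ
  · have : g ξ = 0 := by simpa [h0] using hloc 0 ξ hξ
    simp [F, this]
  rw [not_le] at hξ
  obtain ⟨y, hy, hy1⟩ := hnd ξ (norm_pos_iff.1 (hδ.trans hξ))
  have hyR : ‖y‖ ≤ R := by
    by_contra! h
    nlinarith [mul_lt_mul'' h hξ hR.le hδ.le]
  have hyS : ∀ x, x + y ∈ S ↔ x ∈ S := fun x => by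
    simp only [hS, mem_closedBall_zero_iff]
    constructor
    · intro h
      have := IsUltrametricDist.norm_add_le_max (x + y) (-y)
      rw [add_neg_cancel_right, norm_neg] at this
      exact this.trans (max_le h hyR)
    · intro h
      exact (IsUltrametricDist.norm_add_le_max x y).trans (max_le h hyR)
  have key : ∫ x, F x ξ ∂(haar E) = (χ (B y ξ) : ℂ) * ∫ x, F x ξ ∂(haar E) := by
    conv_lhs => rw [← integral_add_right_eq_self _ y]
    rw [← integral_const_mul]
    congr 1; ext x
    have hi : S.indicator (fun _ => (1 : ℂ)) (x + y) = S.indicator (fun _ => (1 : ℂ)) x := by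
      by_cases hx : x ∈ S
      · simp [hx, (hyS x).2 hx]
      · simp [hx, mt (hyS x).1 hx]
    simp only [F, hi]
    rw [hB.symm ξ (x + y), hB.add_left, AddChar.map_add_eq_mul, Circle.coe_mul, hB.symm x ξ]
    ring
  have h1 : (χ (B y ξ) : ℂ) ≠ 1 := fun h => hy1 (by ext; simpa using h)
  have h2 : (1 - (χ (B y ξ) : ℂ)) * ∫ x, F x ξ ∂(haar E) = 0 := by linear_combination key
  exact (mul_eq_zero.1 h2).resolve_left (sub_ne_zero.2 h1.symm)

/-- Fractional differentiation maps `Φ(E)` to itself. -/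
theorem fracDeriv_mem [IsUltrametricDist E] {χ : AddChar K Circle} (hχ : IsRankZero χ)
    {B : E → E → K} (hB : GoodPairing χ B) (α : ℝ) {φ : E → ℂ} (hφ : φ ∈ lizorkin E) :
    fracDeriv χ B α φ ∈ lizorkin E := by
  have hψ := fourier_mem hχ hB hφ.1
  have hB0 : ∀ x, B x 0 = 0 := fun x => by
    have := hB.norm_le x 0
    rw [norm_zero, mul_zero] at this
    exact norm_le_zero_iff.1 this
  have hψ0 : fourier χ B φ 0 = 0 := by
    unfold fourier
    simpa [hB0] using hφ.2
  set g : E → ℂ := fun ξ => ((‖ξ‖ ^ α : ℝ) : ℂ) * fourier χ B φ ξ with hgdef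
  have hg0 : g 0 = 0 := by simp [hgdef, hψ0]
  have hg : g ∈ bruhatSchwartz E := by
    obtain ⟨⟨δ, hδ, hloc⟩, hsupp⟩ := id hψ
    refine ⟨⟨δ, hδ, fun ξ ξ' h => ?_⟩, hsupp.mul_left⟩
    simp only [hgdef]
    rw [hloc ξ ξ' h]
    by_cases hξ : ‖ξ‖ ≤ δ
    · have : fourier χ B φ ξ = 0 := by simpa [hψ0] using hloc 0 ξ hξ
      simp [this]
    · have hlt : ‖ξ'‖ < ‖ξ‖ := h.trans_lt (not_le.1 hξ)
      rw [IsUltrametricDist.norm_add_eq_max_of_norm_ne_norm hlt.ne', max_eq_left hlt.le]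
  have hfun : fracDeriv χ B α φ = fun x => fourier χ B g (-x) := by
    ext x
    exact fourierInv_eq hB g x
  rw [hfun]
  obtain ⟨⟨δ, hδ, hloc⟩, hsupp⟩ := fourier_mem hχ hB hg
  refine ⟨⟨⟨δ, hδ, fun x x' h => ?_⟩, ?_⟩, ?_⟩
  · show fourier χ B g (-(x + x')) = fourier χ B g (-x)
    rw [neg_add]
    exact hloc (-x) (-x') (by rwa [norm_neg])
  · exact hsupp.comp_homeomorph (Homeomorph.neg E)
  · rw [integral_neg_eq_self (fun x => fourier χ B g x)]
    exact integral_fourier_eq_zero hχ hB hg hg0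

theorem goodPairing_mul [ProperSpace K] {χ : AddChar K Circle} (hχ : IsRankZero χ) :
    GoodPairing χ (fun x ξ : K => x * ξ) where
  cont := by fun_prop
  symm := mul_comm
  add_left := add_mul
  norm_le x ξ := (norm_mul x ξ).le
  nondeg := by
    obtain ⟨x₀, -, h⟩ := hχ.ne_one
    refine ⟨‖x₀‖ + 1, by positivity, fun ξ hξ => ⟨x₀ / ξ, ?_, ?_⟩⟩
    · rw [norm_div, div_mul_cancel₀ _ (norm_ne_zero_iff.2 hξ)]; linarith
    · rwa [div_mul_cancel₀ _ hξ]

theorem goodPairing_dot [ProperSpace K] {χ : AddChar K Circle} (hχ : IsRankZero χ) (n : ℕ) :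
    GoodPairing χ (fun x ξ : Fin n → K => dotProduct x ξ) where
  cont := by unfold dotProduct; fun_prop
  symm := dotProduct_comm
  add_left := add_dotProduct
  norm_le x ξ := by
    unfold dotProduct
    refine IsUltrametricDist.norm_sum_le_of_forall_le_of_nonneg (by positivity) fun i _ => ?_
    rw [norm_mul]
    gcongr <;> exact norm_le_pi_norm _ i
  nondeg := by
    obtain ⟨x₀, -, h⟩ := hχ.ne_one
    refine ⟨‖x₀‖ + 1, by positivity, fun ξ hξ => ?_⟩
    have hn : Nonempty (Fin n) := by
      by_contra hn
      rw [not_nonempty_iff] at hn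
      exact hξ (Subsingleton.elim _ _)
    obtain ⟨j, hj⟩ : ∃ j, ‖ξ‖ = ‖ξ j‖ := by
      obtain ⟨j, -, hj⟩ := Finset.exists_max_image Finset.univ (fun j => ‖ξ j‖)
        Finset.univ_nonempty
      exact ⟨j, le_antisymm ((pi_norm_le_iff_of_nonneg (norm_nonneg _)).2
        fun i => hj i (Finset.mem_univ i)) (norm_le_pi_norm ξ j)⟩
    have hξj : ξ j ≠ 0 := fun h => hξ (norm_eq_zero.1 (by rw [hj, h, norm_zero]))
    refine ⟨Pi.single j (x₀ / ξ j), ?_, ?_⟩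
    · rw [Pi.norm_single, hj, norm_div, div_mul_cancel₀ _ (norm_ne_zero_iff.2 hξj)]
      linarith
    · rwa [single_dotProduct, div_mul_cancel₀ _ hξj]

end Fourier

/-! ### The wave equation -/

section Wave

variable {K : Type*} [NontriviallyNormedField K] [IsUltrametricDist K] [ProperSpace K]
  [MeasurableSpace K] [BorelSpace K]

/-- Vladimirov's operator `D ^ α` on functions `K → ℂ`, with symbol `|ξ| ^ α`. -/
def vladimirov (χ : AddChar K Circle) (α : ℝ) : (K → ℂ) → (K → ℂ) :=
  fracDeriv χ (fun x ξ => x * ξ) α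

/-- The operator `D ^ α` on `Φ(K)`. -/
def lizorkinD {χ : AddChar K Circle} (hχ : IsRankZero χ) (α : ℝ) (φ : lizorkin K) : lizorkin K :=
  ⟨vladimirov χ α φ, fracDeriv_mem hχ (goodPairing_mul hχ) α φ.2⟩

/-- The operator `D ^ {α, n}` on `Φ(Kⁿ)`, with symbol `‖ξ‖ ^ α = maxⱼ |ξⱼ| ^ α`. -/
def lizorkinDn {χ : AddChar K Circle} (hχ : IsRankZero χ) (α : ℝ) {n : ℕ}
    (φ : lizorkin (Fin n → K)) : lizorkin (Fin n → K) :=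
  ⟨fracDeriv χ (fun x ξ => dotProduct x ξ) α φ, fracDeriv_mem hχ (goodPairing_dot hχ n) α φ.2⟩

/-- The function `φ_ω (x) = φ (ω x)`, `|ω| = 1`, for `φ ∈ Φ(K)`. -/
def dilate (ω : K) (hω : ‖ω‖ = 1) (φ : lizorkin K) : lizorkin K :=
  ⟨fun x => (φ : K → ℂ) (ω * x), by
    have hω0 : ω ≠ 0 := fun h => by simp [h] at hω
    obtain ⟨⟨⟨δ, hδ, hloc⟩, hsupp⟩, hint⟩ := id φ.2
    refine ⟨⟨⟨δ, hδ, fun x x' h => ?_⟩, ?_⟩, ?_⟩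
    · show (φ : K → ℂ) (ω * (x + x')) = (φ : K → ℂ) (ω * x)
      rw [mul_add]
      exact hloc _ _ (by rwa [norm_mul, hω, one_mul])
    · exact hsupp.comp_homeomorph (Homeomorph.mulLeft₀ ω hω0)
    · let e : K ≃ₜ+ K :=
        { toFun := fun x => ω * x
          invFun := fun x => ω⁻¹ * x
          left_inv := fun x => inv_mul_cancel_left₀ hω0 x
          right_inv := fun x => mul_inv_cancel_left₀ hω0 x
          map_add' := fun x y => mul_add ω x y
          continuous_toFun := continuous_const_mul ω
          continuous_invFun := continuous_const_mul ω⁻¹ }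
      have : (Measure.map e (haar K)).IsAddHaarMeasure := e.isAddHaarMeasure_map _
      have h2 : ∫ x, (φ : K → ℂ) (ω * x) ∂(haar K) =
          ∫ x, (φ : K → ℂ) x ∂(Measure.map e (haar K)) := by
        rw [integral_map (φ := e) (continuous_const_mul ω).measurable.aemeasurable
          (bruhatSchwartz_continuous φ.2.1).aestronglyMeasurable]
        rfl
      rw [h2, Measure.isAddLeftInvariant_eq_smul (Measure.map e (haar K)) (haar K),
        integral_smul_nnreal_measure, hint, smul_zero]⟩

/-- `Φ'(K, Φ'(Kⁿ))`: distributions over `Φ(K)` with values in `Φ'(Kⁿ)`. (Continuity is automatic,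
see `LizorkinDistribution`.) -/
abbrev VectorDistribution (K : Type*) [NontriviallyNormedField K] [IsUltrametricDist K]
    [ProperSpace K] [MeasurableSpace K] [BorelSpace K] (n : ℕ) : Type _ :=
  lizorkin K →ₗ[ℂ] LizorkinDistribution (Fin n → K)

/-- `F` is a generalized solution of `D_t ^ α F - D_x ^ {α, n} F = 0`. -/
def IsGeneralizedSolution {χ : AddChar K Circle} (hχ : IsRankZero χ) (α : ℝ) {n : ℕ}
    (F : VectorDistribution K n) : Prop :=
  ∀ (φ₁ : lizorkin K) (φ₂ : lizorkin (Fin n → K)),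
    F (lizorkinD hχ α φ₁) φ₂ = F φ₁ (lizorkinDn hχ α φ₂)

/-- `F` is radial in `t`. -/
def IsRadial {n : ℕ} (F : VectorDistribution K n) : Prop :=
  ∀ (ω : K) (hω : ‖ω‖ = 1) (φ : lizorkin K), F (dilate ω hω φ) = F φ

/-- `f ∈ 𝓓(K, Φ'(Kⁿ))`: a function of `t` with values in `Φ'(Kⁿ)` such that `⟨f(t), φ⟩` belongs to
`𝓓(K)` in the variable `t`, for any `φ ∈ Φ(Kⁿ)`. -/
def IsTestFunction {n : ℕ} (f : K → LizorkinDistribution (Fin n → K)) : Prop :=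
  ∀ φ : lizorkin (Fin n → K), (fun t => f t φ) ∈ bruhatSchwartz K

/-- The distribution `F` is (given by) the function `f`. -/
def IsGivenBy {n : ℕ} (F : VectorDistribution K n)
    (f : K → LizorkinDistribution (Fin n → K)) : Prop :=
  ∀ (φ₁ : lizorkin K) (φ₂ : lizorkin (Fin n → K)),
    F φ₁ φ₂ = ∫ t, f t φ₂ * (φ₁ : K → ℂ) t ∂(haar K)

end Wave

end LocalFieldWave

end

/-!
The Fourier transform identifies `Φ(E)` with the space `vanishingAtZero E` of the functions in
`𝓓(E)` that vanish at the origin (`fourierEquiv`). Inversion is reduced to the self-duality of the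
indicator function of the unit ball; this is where the normalization of the absolute value and the
rank of the character enter, and it makes the inversion constants for `K` and `Kⁿ` both equal to
`1`, without which the two symbols `|τ| ^ α` and `‖ξ‖ ^ α` could not be compared.

A function vanishing at the origin is a finite sum of its restrictions to the shells `‖ξ‖ = r`
(`sum_shell`), and a multiplier depending on the norm only acts on a shell as a scalar. So the
equation says `r ^ α * F̂(g₁, g₂) = s ^ α * F̂(g₁, g₂)` for `g₁`, `g₂` on the shells of radii `r`,
`s`, and `F̂` lives on the cone `|τ| = ‖ξ‖` (`fourierDistribution_shell_shell`). Radiality makes `F̂`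
see only the mean value of `g₁` on each shell (`map_shell`): `g₁` is a finite combination of
indicator functions of balls of one radius, and the unit group permutes these balls transitively.
Hence `F` is the superposition, over the radii `r`, of the `profile`s
`t ↦ mean of χ(t τ) over |τ| = r`, with coefficients in `Φ'(Kⁿ)`. Against a given `φ₂` only finitely
many radii count, so that `F` is given by a function in `𝓓(K, Φ'(Kⁿ))` (`representative_isGivenBy`).
The function is unique, as `K` is not compact, so that no nonzero function in `𝓓(K)` is orthogonal
to `Φ(K)` (`eq_zero_of_orthogonal`).

Each profile of a nonempty sphere is an eigenfunction of `D ^ γ` with eigenvalue `r ^ γ ≠ 0` and has the value `1` at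
`t = 0`. Testing with `φ₂` whose Fourier transform lives on a single shell, one therefore reads off
each coefficient from either kind of initial data, which gives `eq_of_initial_data`. The homogeneous
case is the comparison with the zero solution.
-/

open MeasureTheory

noncomputable section

set_option linter.unusedSectionVars false

namespace LocalFieldWave

/-! ### Locally constant functions -/

theorem image_finite_of_eventually_eq {X β : Type*} [TopologicalSpace X] {g : X → β} {C : Set X}
    (hC : IsCompact C) (h : ∀ x ∈ C, ∀ᶠ y in nhds x, g y = g x) : (g '' C).Finite := by
  refine hC.induction_on (p := fun s => (g '' s).Finite) (by simp) (fun s t hst ht => ?_)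
    (fun s t hs ht => ?_) (fun x hx => ?_)
  · exact ht.subset (Set.image_mono hst)
  · rw [Set.image_union]
    exact hs.union ht
  · refine ⟨{y | g y = g x}, mem_nhdsWithin_of_mem_nhds (h x hx), ?_⟩
    refine (Set.finite_singleton (g x)).subset ?_
    rintro _ ⟨y, hy, rfl⟩
    exact hy

section BruhatSchwartz

variable {E : Type*} [NormedAddCommGroup E]

theorem indicator_mem_bruhatSchwartz [ProperSpace E] {S : Set E} {R δ : ℝ}
    (hR : ∀ x ∈ S, ‖x‖ ≤ R) (hδ : 0 < δ) (hS : ∀ x x' : E, ‖x'‖ ≤ δ → (x + x' ∈ S ↔ x ∈ S)) :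
    S.indicator (fun _ => (1 : ℂ)) ∈ bruhatSchwartz E := by
  classical
  refine ⟨⟨δ, hδ, fun x x' h => ?_⟩, ?_⟩
  · simp only [Set.indicator_apply, hS x x' h]
  · refine HasCompactSupport.intro (isCompact_closedBall (0 : E) R) fun x hx => ?_
    refine Set.indicator_of_notMem (fun h => hx ?_) _
    rw [mem_closedBall_zero_iff]
    exact hR x h

theorem comp_add_right_mem_bruhatSchwartz {f : E → ℂ} (hf : f ∈ bruhatSchwartz E) (a : E) :
    (fun x => f (x + a)) ∈ bruhatSchwartz E := by
  obtain ⟨⟨δ, hδ, h⟩, hs⟩ := hf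
  refine ⟨⟨δ, hδ, fun x x' hx => ?_⟩, hs.comp_homeomorph (Homeomorph.addRight a)⟩
  show f (x + x' + a) = f (x + a)
  rw [add_right_comm, h _ _ hx]

theorem comp_neg_mem_bruhatSchwartz {f : E → ℂ} (hf : f ∈ bruhatSchwartz E) :
    (fun x => f (-x)) ∈ bruhatSchwartz E := by
  obtain ⟨⟨δ, hδ, h⟩, hs⟩ := hf
  refine ⟨⟨δ, hδ, fun x x' hx => ?_⟩, hs.comp_homeomorph (Homeomorph.neg E)⟩
  show f (-(x + x')) = f (-x)
  rw [neg_add, h _ _ (by rwa [norm_neg])]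

variable [IsUltrametricDist E]

theorem add_mem_closedBall_iff {a x x' : E} {δ : ℝ} (h : ‖x'‖ ≤ δ) :
    x + x' ∈ Metric.closedBall a δ ↔ x ∈ Metric.closedBall a δ := by
  rw [Metric.mem_closedBall_comm, Metric.mem_closedBall_comm (x := x)]
  have : x + x' ∈ Metric.closedBall x δ := by simpa using h
  rw [← IsUltrametricDist.closedBall_eq_of_mem this]

theorem norm_add_eq_left {x x' : E} (h : ‖x'‖ < ‖x‖) : ‖x + x'‖ = ‖x‖ := by
  rw [IsUltrametricDist.norm_add_eq_max_of_norm_ne_norm h.ne', max_eq_left h.le]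

theorem closedBall_indicator_mem [ProperSpace E] (a : E) {δ : ℝ} (hδ : 0 < δ) :
    (Metric.closedBall a δ).indicator (fun _ => (1 : ℂ)) ∈ bruhatSchwartz E := by
  refine indicator_mem_bruhatSchwartz (R := δ + ‖a‖) (fun x hx => ?_) hδ
    fun x x' h => add_mem_closedBall_iff h
  rw [mem_closedBall_iff_norm] at hx
  linarith [norm_le_norm_add_norm_sub' x a]

end BruhatSchwartz

/-! ### Fourier inversion -/

section Fourier

variable {K : Type*} [NontriviallyNormedField K] [IsUltrametricDist K]
variable {E : Type*} [NormedAddCommGroup E] [ProperSpace E] [MeasurableSpace E] [BorelSpace E]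

/-- A pairing for which the annihilator of the unit ball, with respect to `χ`, is the unit ball
itself. -/
structure SelfDualPairing (χ : AddChar K Circle) (B : E → E → K) : Prop
    extends GoodPairing χ B where
  exists_ne_one : ∀ ξ, 1 < ‖ξ‖ → ∃ x, ‖x‖ ≤ 1 ∧ χ (B x ξ) ≠ 1

theorem GoodPairing.zero_left {χ : AddChar K Circle} {B : E → E → K} (hB : GoodPairing χ B)
    (ξ : E) : B 0 ξ = 0 := by
  simpa using hB.add_left 0 0 ξ

theorem fourier_zero {χ : AddChar K Circle} {B : E → E → K} (hB : GoodPairing χ B) (f : E → ℂ) :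
    fourier χ B f 0 = ∫ x, f x ∂(haar E) := by
  simp [fourier, hB.symm _ 0, hB.zero_left]

theorem integrable_char_mul {χ : AddChar K Circle} (hχ : IsRankZero χ) {B : E → E → K}
    (hB : GoodPairing χ B) {f : E → ℂ} (hf : f ∈ bruhatSchwartz E) (ξ : E) :
    Integrable (fun x => (χ (B x ξ) : ℂ) * f x) (haar E) := by
  have h1 : Continuous fun x : E => (χ (B x ξ) : ℂ) :=
    hχ.continuous.comp (hB.cont.comp (continuous_id.prodMk continuous_const))
  exact (h1.mul (bruhatSchwartz_continuous hf)).integrable_of_hasCompactSupport hf.2.mul_left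

theorem fourier_add {χ : AddChar K Circle} (hχ : IsRankZero χ) {B : E → E → K}
    (hB : GoodPairing χ B) {f g : E → ℂ} (hf : f ∈ bruhatSchwartz E)
    (hg : g ∈ bruhatSchwartz E) : fourier χ B (f + g) = fourier χ B f + fourier χ B g := by
  ext ξ
  simp only [fourier, Pi.add_apply, mul_add]
  exact integral_add (integrable_char_mul hχ hB hf ξ) (integrable_char_mul hχ hB hg ξ)

theorem fourier_smul (χ : AddChar K Circle) (B : E → E → K) (c : ℂ) (f : E → ℂ) :
    fourier χ B (c • f) = c • fourier χ B f := by
  ext ξ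
  simp only [fourier, Pi.smul_apply, smul_eq_mul]
  rw [← integral_const_mul]
  congr 1; ext x; ring

/-- The Fourier transform is symmetric for the bilinear pairing of functions (Fubini). -/
theorem integral_mul_fourier {χ : AddChar K Circle} (hχ : IsRankZero χ) {B : E → E → K}
    (hB : GoodPairing χ B) {f g : E → ℂ} (hf : f ∈ bruhatSchwartz E)
    (hg : g ∈ bruhatSchwartz E) :
    ∫ ξ, g ξ * fourier χ B f ξ ∂(haar E) = ∫ x, fourier χ B g x * f x ∂(haar E) := by
  let H : E → E → ℂ := fun ξ x => g ξ * ((χ (B x ξ) : ℂ) * f x)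
  have hc : Continuous H.uncurry := by
    have h1 : Continuous fun p : E × E => (χ (B p.2 p.1) : ℂ) :=
      hχ.continuous.comp (hB.cont.comp continuous_swap)
    exact ((bruhatSchwartz_continuous hg).comp continuous_fst).mul
      (h1.mul ((bruhatSchwartz_continuous hf).comp continuous_snd))
  have hs : HasCompactSupport H.uncurry := by
    refine HasCompactSupport.intro (hg.2.isCompact.prod hf.2.isCompact) ?_
    rintro ⟨ξ, x⟩ h
    by_cases hξ : ξ ∈ tsupport g
    · have : x ∉ tsupport f := fun h' => h ⟨hξ, h'⟩
      simp [H, Function.uncurry, image_eq_zero_of_notMem_tsupport this]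
    · simp [H, Function.uncurry, image_eq_zero_of_notMem_tsupport hξ]
  calc ∫ ξ, g ξ * fourier χ B f ξ ∂(haar E) = ∫ ξ, ∫ x, H ξ x ∂(haar E) ∂(haar E) := by
        congr 1; ext ξ
        simp only [H, fourier]
        rw [integral_const_mul]
    _ = ∫ x, ∫ ξ, H ξ x ∂(haar E) ∂(haar E) := integral_integral_swap_of_hasCompactSupport hc hs
    _ = ∫ x, fourier χ B g x * f x ∂(haar E) := by
        congr 1; ext x
        simp only [H, fourier]
        rw [← integral_mul_const]
        congr 1; ext ξ
        rw [hB.symm x ξ]; ring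

theorem haar_closedBall_one : haar E (Metric.closedBall 0 1) = 1 :=
  Measure.addHaarMeasure_self (K₀ := unitBall E)

variable [IsUltrametricDist E]

/-- The indicator function of the unit ball is its own Fourier transform. -/
theorem fourier_unitBall {χ : AddChar K Circle} (hχ : IsRankZero χ) {B : E → E → K}
    (hB : SelfDualPairing χ B) :
    fourier χ B ((Metric.closedBall (0 : E) 1).indicator fun _ => (1 : ℂ)) =
      (Metric.closedBall (0 : E) 1).indicator fun _ => (1 : ℂ) := by
  classical
  ext ξ
  by_cases hξ : ‖ξ‖ ≤ 1
  · rw [Set.indicator_of_mem (by simpa using hξ)]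
    have : ∀ x : E, (χ (B x ξ) : ℂ) * (Metric.closedBall (0 : E) 1).indicator (fun _ => 1) x =
        (Metric.closedBall (0 : E) 1).indicator (fun _ => (1 : ℂ)) x := fun x => by
      by_cases hx : x ∈ Metric.closedBall (0 : E) 1
      · have h1 : ‖x‖ ≤ 1 := by simpa using hx
        rw [hχ.eq_one _ ((hB.norm_le x ξ).trans (mul_le_one₀ h1 (norm_nonneg _) hξ))]
        simp
      · simp [hx]
    simp only [fourier, this]
    rw [integral_indicator Metric.isClosed_closedBall.measurableSet]
    simp [Measure.real, haar_closedBall_one]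
  · rw [Set.indicator_of_notMem (by simpa using hξ)]
    obtain ⟨y, hy, hy1⟩ := hB.exists_ne_one ξ (not_le.1 hξ)
    set g : E → ℂ := (Metric.closedBall (0 : E) 1).indicator fun _ => (1 : ℂ)
    have hg : ∀ x, g (x + y) = g x := fun x => by
      simp only [g, Set.indicator_apply, add_mem_closedBall_iff hy]
    have key : fourier χ B g ξ = (χ (B y ξ) : ℂ) * fourier χ B g ξ := by
      conv_lhs => unfold fourier
      rw [← integral_add_right_eq_self _ y]
      unfold fourier
      rw [← integral_const_mul]
      congr 1; ext x
      rw [hg, hB.add_left, AddChar.map_add_eq_mul, Circle.coe_mul]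
      ring
    have h1 : (χ (B y ξ) : ℂ) ≠ 1 := fun h => hy1 (by ext; simpa using h)
    have h2 : (1 - (χ (B y ξ) : ℂ)) * fourier χ B g ξ = 0 := by linear_combination key
    exact (mul_eq_zero.1 h2).resolve_left (sub_ne_zero.2 h1.symm)

/-- Fourier inversion at the origin: subtracting `f 0` times the indicator function of the unit
ball reduces it to the case `f 0 = 0`. -/
theorem integral_fourier {χ : AddChar K Circle} (hχ : IsRankZero χ) {B : E → E → K}
    (hB : SelfDualPairing χ B) {f : E → ℂ} (hf : f ∈ bruhatSchwartz E) :
    ∫ ξ, fourier χ B f ξ ∂(haar E) = f 0 := by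
  obtain ⟨u, hum, hu0, hu1, hFu⟩ : ∃ u ∈ bruhatSchwartz E, u 0 = 1 ∧
      ∫ x, u x ∂(haar E) = 1 ∧ fourier χ B u = u := by
    refine ⟨(Metric.closedBall (0 : E) 1).indicator fun _ => (1 : ℂ),
      closedBall_indicator_mem 0 one_pos, by simp, ?_, fourier_unitBall hχ hB⟩
    rw [integral_indicator Metric.isClosed_closedBall.measurableSet]
    simp [Measure.real, haar_closedBall_one]
  have hum' : (-f 0) • u ∈ bruhatSchwartz E := Submodule.smul_mem _ _ hum
  have h := integral_fourier_eq_zero hχ hB.toGoodPairing (Submodule.add_mem _ hf hum')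
    (by simp [hu0])
  rw [fourier_add hχ hB.toGoodPairing hf hum', fourier_smul, hFu] at h
  have hi : Integrable (fun ξ => -f 0 * u ξ) (haar E) := (bruhatSchwartz_integrable hum).const_mul _
  simp only [Pi.add_apply, Pi.smul_apply, smul_eq_mul] at h
  rw [integral_add (bruhatSchwartz_integrable (fourier_mem hχ hB.toGoodPairing hf)) hi,
    integral_const_mul, hu1] at h
  linear_combination h

theorem fourierInv_fourier {χ : AddChar K Circle} (hχ : IsRankZero χ) {B : E → E → K}
    (hB : SelfDualPairing χ B) {f : E → ℂ} (hf : f ∈ bruhatSchwartz E) :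
    fourierInv χ B (fourier χ B f) = f := by
  ext x
  have h := integral_fourier hχ hB (comp_add_right_mem_bruhatSchwartz hf x)
  rw [zero_add] at h
  rw [← h]
  unfold fourierInv
  congr 1; ext ξ
  unfold fourier
  rw [← integral_const_mul,
    ← integral_add_right_eq_self (fun y => (χ (-B x ξ) : ℂ) * ((χ (B y ξ) : ℂ) * f y)) x]
  congr 1; ext y
  rw [hB.add_left, AddChar.map_add_eq_mul, AddChar.map_neg_eq_inv, Circle.coe_mul,
    Circle.coe_inv]
  have : (χ (B x ξ) : ℂ) ≠ 0 := Circle.coe_ne_zero _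
  field_simp

theorem fourier_fourier {χ : AddChar K Circle} (hχ : IsRankZero χ) {B : E → E → K}
    (hB : SelfDualPairing χ B) {f : E → ℂ} (hf : f ∈ bruhatSchwartz E) (x : E) :
    fourier χ B (fourier χ B f) x = f (-x) := by
  have := congrFun (fourierInv_fourier hχ hB hf) (-x)
  rwa [fourierInv_eq hB.toGoodPairing, neg_neg] at this

theorem fourier_fourierInv {χ : AddChar K Circle} (hχ : IsRankZero χ) {B : E → E → K}
    (hB : SelfDualPairing χ B) {f : E → ℂ} (hf : f ∈ bruhatSchwartz E) :
    fourier χ B (fourierInv χ B f) = f := by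
  have h1 : fourierInv χ B f = fourier χ B fun x => f (-x) := by
    ext x
    rw [fourierInv_eq hB.toGoodPairing]
    unfold fourier
    rw [← integral_neg_eq_self]
    congr 1; ext y
    rw [hB.neg_left, hB.symm y (-x), hB.neg_left, neg_neg, hB.symm]
  ext x
  rw [h1, fourier_fourier hχ hB (comp_neg_mem_bruhatSchwartz hf), neg_neg]

end Fourier

/-! ### The pairings of `K` and `Kⁿ` -/

section Pairings

variable {K : Type*} [NontriviallyNormedField K] [IsUltrametricDist K] [ProperSpace K]

/-- There is no absolute value strictly between `1` and `q`. -/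
theorem IsNormalizedAbs.residueCard_le (hK : IsNormalizedAbs K) {ξ : K} (hξ : 1 < ‖ξ‖) :
    (residueCard K : ℝ) ≤ ‖ξ‖ := by
  obtain ⟨β, hβ, h⟩ := hK
  obtain ⟨y, hy, hy'⟩ := (h ξ⁻¹).1 (by rw [norm_inv]; exact inv_lt_one_of_one_lt₀ hξ)
  have h1 : ‖ξ‖⁻¹ ≤ (residueCard K : ℝ)⁻¹ := by
    rw [← norm_inv, hy', norm_mul, hβ]
    exact mul_le_of_le_one_right (by positivity) hy
  rcases Nat.eq_zero_or_pos (residueCard K) with h0 | h0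
  · rw [h0]; simp
  · exact (inv_le_inv₀ (by positivity) (by positivity)).1 h1

theorem selfDualPairing_mul (hK : IsNormalizedAbs K) {χ : AddChar K Circle}
    (hχ : IsRankZero χ) : SelfDualPairing χ (fun x ξ : K => x * ξ) where
  toGoodPairing := goodPairing_mul hχ
  exists_ne_one ξ hξ := by
    obtain ⟨x₀, hx₀, h⟩ := hχ.ne_one
    have hξ0 : ξ ≠ 0 := norm_pos_iff.1 (one_pos.trans hξ)
    refine ⟨x₀ / ξ, ?_, ?_⟩
    · rw [norm_div, hx₀]
      exact div_le_one_of_le₀ (hK.residueCard_le hξ) (norm_nonneg _)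
    · rwa [div_mul_cancel₀ _ hξ0]

theorem selfDualPairing_dot (hK : IsNormalizedAbs K) {χ : AddChar K Circle}
    (hχ : IsRankZero χ) (n : ℕ) :
    SelfDualPairing χ (fun x ξ : Fin n → K => dotProduct x ξ) where
  toGoodPairing := goodPairing_dot hχ n
  exists_ne_one ξ hξ := by
    obtain ⟨x₀, hx₀, h⟩ := hχ.ne_one
    obtain ⟨j, hj⟩ : ∃ j, 1 < ‖ξ j‖ := by
      by_contra! hj
      exact absurd ((pi_norm_le_iff_of_nonneg one_pos.le).2 hj) (not_le.2 hξ)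
    have hξ0 : ξ j ≠ 0 := norm_pos_iff.1 (one_pos.trans hj)
    refine ⟨Pi.single j (x₀ / ξ j), ?_, ?_⟩
    · rw [Pi.norm_single, norm_div, hx₀]
      exact div_le_one_of_le₀ (hK.residueCard_le hj) (norm_nonneg _)
    · rwa [single_dotProduct, div_mul_cancel₀ _ hξ0]

end Pairings

/-! ### The Fourier image of the Lizorkin space -/

/-- The functions in `𝓓(E)` that vanish at the origin. The Fourier transform maps `Φ(E)` onto
this space. -/
def vanishingAtZero (E : Type*) [NormedAddCommGroup E] : Submodule ℂ (E → ℂ) where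
  carrier := {f | f ∈ bruhatSchwartz E ∧ f 0 = 0}
  zero_mem' := ⟨Submodule.zero_mem _, rfl⟩
  add_mem' := fun hf hg => ⟨Submodule.add_mem _ hf.1 hg.1, by simp [hf.2, hg.2]⟩
  smul_mem' := fun c f hf => ⟨Submodule.smul_mem _ c hf.1, by simp [hf.2]⟩

section FourierEquiv

variable {K : Type*} [NontriviallyNormedField K] [IsUltrametricDist K]
variable {E : Type*} [NormedAddCommGroup E] [ProperSpace E] [MeasurableSpace E] [BorelSpace E]
  [IsUltrametricDist E]

theorem fourierInv_mem_lizorkin {χ : AddChar K Circle} (hχ : IsRankZero χ) {B : E → E → K}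
    (hB : SelfDualPairing χ B) {g : E → ℂ} (hg : g ∈ vanishingAtZero E) :
    fourierInv χ B g ∈ lizorkin E := by
  have h1 : fourierInv χ B g = fun x => fourier χ B g (-x) := by
    ext x
    exact fourierInv_eq hB.toGoodPairing g x
  have h2 : fourierInv χ B g ∈ bruhatSchwartz E := by
    rw [h1]
    exact comp_neg_mem_bruhatSchwartz (fourier_mem hχ hB.toGoodPairing hg.1)
  refine ⟨h2, ?_⟩
  rw [← fourier_zero hB.toGoodPairing, fourier_fourierInv hχ hB hg.1, hg.2]

/-- The Fourier transform as an isomorphism of `Φ(E)` onto the functions in `𝓓(E)` vanishing at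
the origin. -/
def fourierEquiv {χ : AddChar K Circle} (hχ : IsRankZero χ) {B : E → E → K}
    (hB : SelfDualPairing χ B) : lizorkin E ≃ₗ[ℂ] vanishingAtZero E where
  toFun φ := ⟨fourier χ B φ, fourier_mem hχ hB.toGoodPairing φ.2.1, by
    rw [fourier_zero hB.toGoodPairing, φ.2.2]⟩
  map_add' φ ψ := Subtype.ext (fourier_add hχ hB.toGoodPairing φ.2.1 ψ.2.1)
  map_smul' c φ := Subtype.ext (fourier_smul χ B c φ)
  invFun g := ⟨fourierInv χ B g, fourierInv_mem_lizorkin hχ hB g.2⟩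
  left_inv φ := Subtype.ext (fourierInv_fourier hχ hB φ.2.1)
  right_inv g := Subtype.ext (fourier_fourierInv hχ hB g.2.1)

end FourierEquiv

/-! ### Decomposition into shells -/

section Shells

variable {E : Type*} [NormedAddCommGroup E] [IsUltrametricDist E]

theorem vanishingAtZero.exists_radius (g : vanishingAtZero E) :
    ∃ δ > 0, (∀ ξ ξ' : E, ‖ξ'‖ ≤ δ → (g : E → ℂ) (ξ + ξ') = (g : E → ℂ) ξ) ∧
      ∀ ξ : E, ‖ξ‖ ≤ δ → (g : E → ℂ) ξ = 0 := by
  obtain ⟨⟨⟨δ, hδ, h⟩, -⟩, h0⟩ := g.2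
  exact ⟨δ, hδ, h, fun ξ hξ => by simpa [h0] using h 0 ξ hξ⟩

/-- Multiplication by a function `m` of the norm. -/
def radialMul (m : ℝ → ℂ) : vanishingAtZero E →ₗ[ℂ] vanishingAtZero E where
  toFun g := ⟨fun ξ => m ‖ξ‖ * (g : E → ℂ) ξ, by
    obtain ⟨δ, hδ, h, hz⟩ := vanishingAtZero.exists_radius g
    refine ⟨⟨⟨δ, hδ, fun ξ ξ' hξ' => ?_⟩, g.2.1.2.mul_left⟩, by simp [g.2.2]⟩
    simp only [h ξ ξ' hξ']
    rcases le_or_gt ‖ξ‖ δ with hξ | hξ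
    · simp [hz ξ hξ]
    · rw [norm_add_eq_left (hξ'.trans_lt hξ)]⟩
  map_add' f g := Subtype.ext (funext fun ξ => mul_add _ _ _)
  map_smul' c f := Subtype.ext (funext fun ξ => mul_left_comm _ _ _)

theorem radialMul_apply (m : ℝ → ℂ) (g : vanishingAtZero E) (ξ : E) :
    (radialMul m g : E → ℂ) ξ = m ‖ξ‖ * (g : E → ℂ) ξ := rfl

/-- The restriction of a function to the shell `‖ξ‖ = r`. -/
def shell (r : ℝ) : vanishingAtZero E →ₗ[ℂ] vanishingAtZero E :=
  radialMul (Pi.single r 1)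

theorem shell_apply (r : ℝ) (g : vanishingAtZero E) (ξ : E) :
    (shell r g : E → ℂ) ξ = if ‖ξ‖ = r then (g : E → ℂ) ξ else 0 := by
  simp [shell, radialMul_apply, Pi.single_apply]

theorem shell_of_nonpos {r : ℝ} (hr : r ≤ 0) (g : vanishingAtZero E) : shell r g = 0 := by
  ext ξ
  rw [shell_apply]
  split_ifs with h
  · have : ξ = 0 := norm_le_zero_iff.1 (h.trans_le hr)
    rw [this, g.2.2]; rfl
  · rfl

theorem shell_shell (r s : ℝ) (g : vanishingAtZero E) :
    shell r (shell s g) = if r = s then shell r g else 0 := by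
  ext ξ
  split_ifs with h
  · subst h
    simp only [shell_apply]
    split_ifs <;> rfl
  · simp only [shell_apply]
    split_ifs with h1 h2
    · exact absurd (h1.symm.trans h2) h
    all_goals rfl

theorem radialMul_shell (m : ℝ → ℂ) (r : ℝ) (g : vanishingAtZero E) :
    radialMul m (shell r g) = m r • shell r g := by
  ext ξ
  simp only [radialMul_apply, shell_apply, Submodule.coe_smul, Pi.smul_apply, smul_eq_mul]
  split_ifs with h
  · rw [h]
  · simp

/-- A function meets only finitely many shells, as the norm is locally constant away from the
origin. -/
theorem shell_finite (g : vanishingAtZero E) : {r : ℝ | shell r g ≠ 0}.Finite := by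
  obtain ⟨δ, hδ, h, hz⟩ := vanishingAtZero.exists_radius g
  have hfin : ((fun ξ : E => ‖ξ‖) '' (tsupport (g : E → ℂ) ∩ {ξ | δ ≤ ‖ξ‖})).Finite := by
    refine image_finite_of_eventually_eq
      (g.2.1.2.isCompact.inter_right (isClosed_le continuous_const continuous_norm))
      fun ξ hξ => ?_
    filter_upwards [Metric.ball_mem_nhds ξ hδ] with η hη
    have := norm_add_eq_left (x := ξ) (x' := η - ξ)
      ((mem_ball_iff_norm.1 hη).trans_le hξ.2)
    rwa [add_sub_cancel] at this
  refine hfin.subset fun r hr => ?_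
  by_contra hr'
  refine hr ?_
  ext ξ
  rw [shell_apply]
  split_ifs with hξ
  · by_contra h0
    refine hr' ⟨ξ, ⟨subset_tsupport _ h0, ?_⟩, hξ⟩
    by_contra hlt
    exact h0 (hz ξ (not_le.1 hlt).le)
  · rfl

theorem sum_shell {g : vanishingAtZero E} {T : Finset ℝ} (hT : {r : ℝ | shell r g ≠ 0} ⊆ T) :
    ∑ r ∈ T, shell r g = g := by
  ext ξ
  rw [Submodule.coe_sum, Finset.sum_apply]
  simp only [shell_apply, Finset.sum_ite_eq]
  split_ifs with h
  · rfl
  · have : shell ‖ξ‖ g = 0 := by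
      by_contra h'
      exact h (hT h')
    have := congrFun (congrArg Subtype.val this) ξ
    rw [shell_apply, if_pos rfl] at this
    exact this.symm

variable (E) in
/-- The sphere of radius `r`; it is taken to be empty for `r = 0`. -/
def sphere (r : ℝ) : Set E := {ξ | ‖ξ‖ = r ∧ ξ ≠ 0}

theorem pos_of_mem_sphere {r : ℝ} {ξ : E} (h : ξ ∈ sphere E r) : 0 < r :=
  h.1 ▸ norm_pos_iff.2 h.2

theorem closedBall_subset_sphere {r δ : ℝ} {ξ : E} (h : ξ ∈ sphere E r) (hδ : δ < r) :
    Metric.closedBall ξ δ ⊆ sphere E r := fun η hη => by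
  have h1 := norm_add_eq_left (x := ξ) (x' := η - ξ)
      ((mem_closedBall_iff_norm.1 hη).trans_lt (h.1 ▸ hδ))
  rw [add_sub_cancel] at h1
  exact ⟨h1.trans h.1, norm_pos_iff.1 (by rw [h1, h.1]; exact pos_of_mem_sphere h)⟩

theorem isOpen_sphere (r : ℝ) : IsOpen (sphere E r) := by
  refine Metric.isOpen_iff.2 fun ξ hξ => ⟨r / 2, half_pos (pos_of_mem_sphere hξ), ?_⟩
  exact Metric.ball_subset_closedBall.trans
    (closedBall_subset_sphere hξ (half_lt_self (pos_of_mem_sphere hξ)))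

variable [ProperSpace E]

variable (E) in
/-- The indicator function of the sphere of radius `r`. -/
def sphereIndicator (r : ℝ) : vanishingAtZero E :=
  ⟨(sphere E r).indicator fun _ => 1, by
    rcases le_or_gt r 0 with hr | hr
    · rw [show sphere E r = ∅ from
        Set.eq_empty_of_forall_notMem fun ξ hξ => (pos_of_mem_sphere hξ).not_ge hr]
      rw [Set.indicator_empty]
      exact Submodule.zero_mem _
    refine ⟨indicator_mem_bruhatSchwartz (R := r) (fun x hx => hx.1.le) (half_pos hr)
      fun x x' h => ⟨fun hx => ?_, fun hx => ?_⟩, by simp [sphere]⟩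
    · refine closedBall_subset_sphere hx (half_lt_self hr) ?_
      simpa using h
    · refine closedBall_subset_sphere hx (half_lt_self hr) ?_
      simpa using h⟩

theorem shell_sphereIndicator (r : ℝ) : shell r (sphereIndicator E r) = sphereIndicator E r := by
  ext ξ
  rw [shell_apply]
  split_ifs with h
  · rfl
  · simp [sphereIndicator, sphere, h]

theorem sphereIndicator_mul (r : ℝ) (g : vanishingAtZero E) (ξ : E) :
    (sphereIndicator E r : E → ℂ) ξ * (g : E → ℂ) ξ = (shell r g : E → ℂ) ξ := by
  rw [shell_apply]
  by_cases h0 : ξ = 0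
  · simp [h0, g.2.2]
  · by_cases h : ‖ξ‖ = r <;> simp [sphereIndicator, sphere, h, h0]

variable [MeasurableSpace E] [BorelSpace E]

theorem integral_sphereIndicator (r : ℝ) :
    ∫ ξ, (sphereIndicator E r : E → ℂ) ξ ∂(haar E) = (haar E).real (sphere E r) := by
  show ∫ ξ, (sphere E r).indicator (fun _ => (1 : ℂ)) ξ ∂(haar E) = _
  rw [integral_indicator (isOpen_sphere r).measurableSet]
  simp

theorem haar_sphere_ne_zero {r : ℝ} (h : sphereIndicator E r ≠ 0) :
    (haar E).real (sphere E r) ≠ 0 := by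
  have hne : (sphere E r).Nonempty := by
    by_contra hne
    refine h (Subtype.ext ?_)
    show (sphere E r).indicator (fun _ => (1 : ℂ)) = 0
    rw [Set.not_nonempty_iff_eq_empty.1 hne, Set.indicator_empty]
    rfl
  have hfin : haar E (sphere E r) ≠ ⊤ := by
    refine ((measure_mono fun ξ hξ => ?_).trans_lt
      (isCompact_closedBall (0 : E) r).measure_lt_top).ne
    simpa using hξ.1.le
  rw [Measure.real, ENNReal.toReal_ne_zero]
  exact ⟨((isOpen_sphere r).measure_pos _ hne).ne', hfin⟩

end Shells

/-! ### Functionals that are invariant under the unit group -/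

section Radial

variable {K : Type*} [NontriviallyNormedField K] [IsUltrametricDist K] [ProperSpace K]
  [MeasurableSpace K] [BorelSpace K]

/-- Multiplication by a unit preserves the Haar measure. -/
theorem integral_comp_mul_left_of_norm_one {ω : K} (hω : ‖ω‖ = 1) {f : K → ℂ}
    (hf : Continuous f) : ∫ x, f (ω * x) ∂(haar K) = ∫ x, f x ∂(haar K) := by
  have hω0 : ω ≠ 0 := fun h => by simp [h] at hω
  let e : K ≃ₜ+ K :=
    { toFun := fun x => ω * x
      invFun := fun x => ω⁻¹ * x
      left_inv := fun x => inv_mul_cancel_left₀ hω0 x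
      right_inv := fun x => mul_inv_cancel_left₀ hω0 x
      map_add' := fun x y => mul_add ω x y
      continuous_toFun := continuous_const_mul ω
      continuous_invFun := continuous_const_mul ω⁻¹ }
  have he : Measurable e := (continuous_const_mul ω).measurable
  have : (Measure.map e (haar K)).IsAddHaarMeasure := e.isAddHaarMeasure_map _
  have h1 : Measure.map e (haar K) = haar K := by
    have h2 : Measure.map e (haar K) (unitBall K : Set K) = 1 := by
      have h3 : e ⁻¹' (unitBall K : Set K) = (unitBall K : Set K) := by
        ext x
        show ω * x ∈ Metric.closedBall (0 : K) 1 ↔ x ∈ Metric.closedBall (0 : K) 1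
        simp [hω]
      rw [Measure.map_apply he (unitBall K).isCompact.isClosed.measurableSet, h3]
      exact Measure.addHaarMeasure_self
    rw [Measure.addHaarMeasure_unique (Measure.map e (haar K)) (unitBall K), h2, one_smul]
    rfl
  conv_rhs => rw [← h1]
  rw [integral_map he.aemeasurable hf.aestronglyMeasurable]
  rfl

/-- The function `g_ω (ξ) = g (ω ξ)`, `|ω| = 1`. -/
def unitDilate (ω : K) (hω : ‖ω‖ = 1) (g : vanishingAtZero K) : vanishingAtZero K :=
  ⟨fun ξ => (g : K → ℂ) (ω * ξ), by
    have hω0 : ω ≠ 0 := fun h => by simp [h] at hω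
    obtain ⟨⟨⟨δ, hδ, h⟩, hs⟩, h0⟩ := id g.2
    refine ⟨⟨⟨δ, hδ, fun ξ ξ' hξ => ?_⟩, hs.comp_homeomorph (Homeomorph.mulLeft₀ ω hω0)⟩, ?_⟩
    · show (g : K → ℂ) (ω * (ξ + ξ')) = (g : K → ℂ) (ω * ξ)
      rw [mul_add, h _ _ (by rwa [norm_mul, hω, one_mul])]
    · show (g : K → ℂ) (ω * 0) = 0
      rw [mul_zero, h0]⟩

theorem fourierInv_comp_mul_left (χ : AddChar K Circle) (hχ : IsRankZero χ) {ω : K}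
    (hω : ‖ω‖ = 1) {g : K → ℂ} (hg : Continuous g) (x : K) :
    fourierInv χ (fun x ξ : K => x * ξ) (fun ξ => g (ω * ξ)) x =
      fourierInv χ (fun x ξ : K => x * ξ) g (ω⁻¹ * x) := by
  have hω0 : ω ≠ 0 := fun h => by simp [h] at hω
  have hc : Continuous fun ξ : K => (χ (-(ω⁻¹ * x * ξ)) : ℂ) * g ξ :=
    (hχ.continuous.comp (by fun_prop)).mul hg
  unfold fourierInv
  rw [← integral_comp_mul_left_of_norm_one hω hc]
  congr 1; ext ξ
  congr 4
  field_simp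

/-- The indicator function of the ball `b + {‖ξ‖ ≤ δ}`, for `δ < ‖b‖`. -/
def ballIndicator (b : K) (δ : ℝ) (hδ : 0 < δ) (hb : δ < ‖b‖) : vanishingAtZero K :=
  ⟨(Metric.closedBall b δ).indicator fun _ => 1, closedBall_indicator_mem b hδ,
    Set.indicator_of_notMem (by simpa [dist_zero_left] using hb) _⟩

variable {V : Type*} [AddCommGroup V] [Module ℂ V]

/-- A functional that is invariant under the unit group takes the same value on any two balls of
the same radius in the same sphere. -/
theorem map_ballIndicator_eq {L : vanishingAtZero K →ₗ[ℂ] V}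
    (hL : ∀ (ω : K) (hω : ‖ω‖ = 1) (g : vanishingAtZero K), L (unitDilate ω hω g) = L g)
    {a b : K} {δ : ℝ} (hδ : 0 < δ) (ha : δ < ‖a‖) (hb : δ < ‖b‖) (hab : ‖a‖ = ‖b‖) :
    L (ballIndicator a δ hδ ha) = L (ballIndicator b δ hδ hb) := by
  have hb0 : b ≠ 0 := norm_pos_iff.1 (hδ.trans hb)
  have ha0 : a ≠ 0 := norm_pos_iff.1 (hδ.trans ha)
  have hω : ‖a / b‖ = 1 := by rw [norm_div, hab, div_self (norm_ne_zero_iff.2 hb0)]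
  rw [← hL (a / b) hω (ballIndicator a δ hδ ha)]
  congr 1
  ext ξ
  show (Metric.closedBall a δ).indicator (fun _ => (1 : ℂ)) (a / b * ξ) =
    (Metric.closedBall b δ).indicator (fun _ => (1 : ℂ)) ξ
  have h : a / b * ξ ∈ Metric.closedBall a δ ↔ ξ ∈ Metric.closedBall b δ := by
    rw [mem_closedBall_iff_norm, mem_closedBall_iff_norm,
      show a / b * ξ - a = a / b * (ξ - b) by field_simp, norm_mul, hω, one_mul]
  classical
  simp only [Set.indicator_apply, h]

/-- A functional that is invariant under the unit group kills the functions on a sphere that have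
zero integral: such a function is a finite linear combination, with coefficients summing to zero,
of indicator functions of balls of equal radius in the sphere. -/
theorem map_eq_zero_of_integral_eq_zero {L : vanishingAtZero K →ₗ[ℂ] V}
    (hL : ∀ (ω : K) (hω : ‖ω‖ = 1) (g : vanishingAtZero K), L (unitDilate ω hω g) = L g)
    {r : ℝ} {g : vanishingAtZero K} (hg : shell r g = g)
    (hint : ∫ ξ, (g : K → ℂ) ξ ∂(haar K) = 0) : L g = 0 := by
  classical
  obtain ⟨δ, hδ, hloc, hz⟩ := vanishingAtZero.exists_radius g
  have hnorm : ∀ ξ, (g : K → ℂ) ξ ≠ 0 → ‖ξ‖ = r := fun ξ hξ => by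
    by_contra h
    rw [← hg, shell_apply, if_neg h] at hξ
    exact hξ rfl
  have hlt : ∀ ξ, (g : K → ℂ) ξ ≠ 0 → δ < ‖ξ‖ := fun ξ hξ => by
    by_contra h
    exact hξ (hz ξ (not_lt.1 h))
  have hfin : ((fun ξ : K => Metric.closedBall ξ δ) '' Function.support (g : K → ℂ)).Finite := by
    refine (image_finite_of_eventually_eq g.2.1.2.isCompact fun ξ _ => ?_).subset
      (Set.image_mono (subset_tsupport _))
    filter_upwards [Metric.closedBall_mem_nhds ξ hδ] with η hη
    exact (IsUltrametricDist.closedBall_eq_of_mem hη).symm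
  by_cases hne : (Function.support (g : K → ℂ)).Nonempty
  swap
  · have : g = 0 := by
      ext ξ
      by_contra h
      exact hne ⟨ξ, h⟩
    rw [this, map_zero]
  obtain ⟨b, hb⟩ := hne
  -- `c s` is a centre, in the support of `g`, of the ball `s`.
  have hcen : ∀ s : Set K, ∃ ξ, (g : K → ℂ) ξ ≠ 0 ∧ (s ∈ hfin.toFinset →
      Metric.closedBall ξ δ = s) := fun s => by
    by_cases hs : s ∈ hfin.toFinset
    · obtain ⟨ξ, hξ, h⟩ := hfin.mem_toFinset.1 hs
      exact ⟨ξ, hξ, fun _ => h⟩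
    · exact ⟨b, hb, fun h => absurd h hs⟩
  choose c hc hcs using hcen
  have hsum : g = ∑ s ∈ hfin.toFinset,
      (g : K → ℂ) (c s) • ballIndicator (c s) δ hδ (hlt _ (hc s)) := by
    ext ξ
    rw [Submodule.coe_sum, Finset.sum_apply]
    have hval : ∀ s ∈ hfin.toFinset,
        ((g : K → ℂ) (c s) • ballIndicator (c s) δ hδ (hlt _ (hc s)) : vanishingAtZero K).1 ξ =
          if Metric.closedBall ξ δ = s then (g : K → ℂ) ξ else 0 := fun s hs => by
      show (g : K → ℂ) (c s) * (Metric.closedBall (c s) δ).indicator (fun _ => (1 : ℂ)) ξ = _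
      by_cases hξ : ξ ∈ Metric.closedBall (c s) δ
      · rw [Set.indicator_of_mem hξ, ← IsUltrametricDist.closedBall_eq_of_mem hξ,
          if_pos (hcs s hs), mul_one]
        have := hloc (c s) (ξ - c s) (mem_closedBall_iff_norm.1 hξ)
        rw [add_sub_cancel] at this
        exact this.symm
      · rw [Set.indicator_of_notMem hξ, mul_zero, if_neg]
        intro h
        refine hξ ?_
        rw [hcs s hs, ← h]
        exact Metric.mem_closedBall_self hδ.le
    rw [Finset.sum_congr rfl hval, Finset.sum_ite_eq]
    split_ifs with h
    · rfl
    · by_contra h0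
      exact h (hfin.mem_toFinset.2 ⟨ξ, h0, rfl⟩)
  have hμ : ∀ s, ∫ ξ, (ballIndicator (c s) δ hδ (hlt _ (hc s)) : K → ℂ) ξ ∂(haar K) =
      (haar K).real (Metric.closedBall 0 δ) := fun s => by
    show ∫ ξ, (Metric.closedBall (c s) δ).indicator (fun _ => (1 : ℂ)) ξ ∂(haar K) = _
    rw [integral_indicator Metric.isClosed_closedBall.measurableSet]
    simp [Measure.real, Measure.addHaar_closedBall_center]
  have hμ0 : ((haar K).real (Metric.closedBall (0 : K) δ) : ℂ) ≠ 0 := by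
    rw [Complex.ofReal_ne_zero, Measure.real, ENNReal.toReal_ne_zero]
    exact ⟨(Metric.measure_closedBall_pos _ _ hδ).ne',
      (isCompact_closedBall (0 : K) δ).measure_lt_top.ne⟩
  have hcoef : ∑ s ∈ hfin.toFinset, (g : K → ℂ) (c s) = 0 := by
    have h1 : ∫ ξ, (g : K → ℂ) ξ ∂(haar K) =
        ∑ s ∈ hfin.toFinset, (g : K → ℂ) (c s) * (haar K).real (Metric.closedBall (0 : K) δ) := by
      conv_lhs => rw [hsum]
      simp only [Submodule.coe_sum, Finset.sum_apply, Submodule.coe_smul, Pi.smul_apply,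
        smul_eq_mul]
      rw [integral_finsetSum _ fun s _ => (bruhatSchwartz_integrable
        (ballIndicator (c s) δ hδ (hlt _ (hc s))).2.1).const_mul _]
      refine Finset.sum_congr rfl fun s _ => ?_
      rw [integral_const_mul, hμ]
    rw [hint, ← Finset.sum_mul] at h1
    exact (mul_eq_zero.1 h1.symm).resolve_right hμ0
  rw [hsum, map_sum]
  have : ∀ s ∈ hfin.toFinset,
      L ((g : K → ℂ) (c s) • ballIndicator (c s) δ hδ (hlt _ (hc s))) =
        (g : K → ℂ) (c s) • L (ballIndicator b δ hδ (hlt b hb)) := fun s _ => by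
    rw [map_smul, map_ballIndicator_eq hL hδ _ (hlt b hb)
      ((hnorm _ (hc s)).trans (hnorm b hb).symm)]
  rw [Finset.sum_congr rfl this, ← Finset.sum_smul, hcoef, zero_smul]

/-- On a sphere, a functional that is invariant under the unit group only depends on the mean
value of the function. -/
theorem map_shell {L : vanishingAtZero K →ₗ[ℂ] V}
    (hL : ∀ (ω : K) (hω : ‖ω‖ = 1) (g : vanishingAtZero K), L (unitDilate ω hω g) = L g)
    (r : ℝ) (g : vanishingAtZero K) :
    L (shell r g) = (((haar K).real (sphere K r) : ℂ)⁻¹ *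
      ∫ ξ, (shell r g : K → ℂ) ξ ∂(haar K)) • L (sphereIndicator K r) := by
  set I := ∫ ξ, (shell r g : K → ℂ) ξ ∂(haar K) with hI
  set μ : ℂ := ((haar K).real (sphere K r) : ℂ) with hμ
  by_cases h0 : sphereIndicator K r = 0
  · have : shell r g = 0 := by
      ext ξ
      rw [← sphereIndicator_mul, h0]
      exact zero_mul _
    rw [this, h0, map_zero, smul_zero]
  have hμ0 : μ ≠ 0 := Complex.ofReal_ne_zero.2 (haar_sphere_ne_zero h0)
  have key : L (shell r g - (μ⁻¹ * I) • sphereIndicator K r) = 0 := by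
    refine map_eq_zero_of_integral_eq_zero (r := r) hL ?_ ?_
    · rw [map_sub, map_smul, shell_shell, if_pos rfl, shell_sphereIndicator]
    · show ∫ ξ, ((shell r g : K → ℂ) ξ - (μ⁻¹ * I) * (sphereIndicator K r : K → ℂ) ξ) ∂(haar K) = 0
      rw [integral_sub (bruhatSchwartz_integrable (shell r g).2.1)
        ((bruhatSchwartz_integrable (sphereIndicator K r).2.1).const_mul _), integral_const_mul,
        integral_sphereIndicator, ← hI, ← hμ]
      field_simp
      ring
  rw [map_sub, map_smul, sub_eq_zero] at key
  exact key

end Radial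

/-! ### Uniqueness of the representing function -/

section Uniqueness

variable {K : Type*} [NontriviallyNormedField K] [IsUltrametricDist K] [ProperSpace K]
  [MeasurableSpace K] [BorelSpace K]

/-- A function `h ∈ 𝓓(K)` orthogonal to `Φ(K)` vanishes: test it against the difference of `h̄` and
a translate of `h̄` whose support is disjoint from that of `h`. -/
theorem eq_zero_of_orthogonal {h : K → ℂ} (hh : h ∈ bruhatSchwartz K)
    (horth : ∀ φ : lizorkin K, ∫ t, h t * (φ : K → ℂ) t ∂(haar K) = 0) : h = 0 := by
  obtain ⟨R, hR⟩ := hh.2.isCompact.isBounded.subset_closedBall 0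
  have hR' : ∀ x, h x ≠ 0 → ‖x‖ ≤ R := fun x hx => by
    simpa using hR (subset_tsupport h hx)
  obtain ⟨a, ha⟩ := NormedField.exists_lt_norm K R
  have hcm : (fun x => starRingEnd ℂ (h x)) ∈ bruhatSchwartz K := by
    obtain ⟨⟨δ, hδ, hl⟩, hs⟩ := hh
    exact ⟨⟨δ, hδ, fun x x' hx => congrArg _ (hl x x' hx)⟩,
      hs.comp_left (g := starRingEnd ℂ) (map_zero _)⟩
  have hcm' := comp_add_right_mem_bruhatSchwartz hcm a
  let φ : lizorkin K := ⟨(fun x => starRingEnd ℂ (h x)) - fun x => starRingEnd ℂ (h (x + a)),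
    Submodule.sub_mem _ hcm hcm', by
      simp only [Pi.sub_apply]
      rw [integral_sub (bruhatSchwartz_integrable hcm) (bruhatSchwartz_integrable hcm'),
        integral_add_right_eq_self (fun x => starRingEnd ℂ (h x)), sub_self]⟩
  have h1 : ∀ t, h t * (φ : K → ℂ) t = ((‖h t‖ ^ 2 : ℝ) : ℂ) := fun t => by
    show h t * (starRingEnd ℂ (h t) - starRingEnd ℂ (h (t + a))) = _
    have h2 : h t * starRingEnd ℂ (h (t + a)) = 0 := by
      by_contra hne
      obtain ⟨h3, h4⟩ := mul_ne_zero_iff.1 hne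
      have h5 := IsUltrametricDist.norm_add_le_max (t + a) (-t)
      rw [add_neg_cancel_comm, norm_neg] at h5
      exact absurd (h5.trans (max_le (hR' _ fun h' => h4 (by rw [h', map_zero])) (hR' _ h3)))
        (not_le.2 ha)
    rw [mul_sub, h2, sub_zero, Complex.mul_conj, Complex.normSq_eq_norm_sq]
  have h2 := horth φ
  simp only [h1] at h2
  rw [integral_complex_ofReal, Complex.ofReal_eq_zero] at h2
  have hcont : Continuous fun t => ‖h t‖ ^ 2 := (bruhatSchwartz_continuous hh).norm.pow 2
  have hcs : HasCompactSupport fun t => ‖h t‖ ^ 2 :=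
    hh.2.comp_left (g := fun z : ℂ => ‖z‖ ^ 2) (by simp)
  by_contra hne
  obtain ⟨t, ht⟩ := Function.ne_iff.1 hne
  refine (hcont.integral_pos_of_hasCompactSupport_nonneg_nonzero (μ := haar K) (x := t) hcs
    (fun s => by positivity) ?_).ne' h2
  simpa using ht

theorem IsGivenBy.unique {n : ℕ} {F : VectorDistribution K n}
    {f g : K → LizorkinDistribution (Fin n → K)} (hf : IsTestFunction f) (hfF : IsGivenBy F f)
    (hg : IsTestFunction g) (hgF : IsGivenBy F g) : f = g := by
  ext t φ
  have h : (fun t => f t φ) - (fun t => g t φ) = 0 := by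
    refine eq_zero_of_orthogonal (Submodule.sub_mem _ (hf φ) (hg φ)) fun φ₁ => ?_
    have h1 : ∀ {u : K → ℂ}, u ∈ bruhatSchwartz K →
        Integrable (fun t => u t * (φ₁ : K → ℂ) t) (haar K) := fun hu =>
      ((bruhatSchwartz_continuous hu).mul
        (bruhatSchwartz_continuous φ₁.2.1)).integrable_of_hasCompactSupport hu.2.mul_right
    simp only [Pi.sub_apply, sub_mul]
    rw [integral_sub (h1 (hf φ)) (h1 (hg φ)), ← hfF φ₁ φ, ← hgF φ₁ φ, sub_self]
  exact sub_eq_zero.1 (congrFun h t)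

end Uniqueness

/-! ### The function representing a solution -/

section Solution

variable {K : Type*} [NontriviallyNormedField K] [IsUltrametricDist K] [ProperSpace K]
  [MeasurableSpace K] [BorelSpace K]

/-- The radial profile on the sphere of radius `r`: the mean of `τ ↦ χ(t τ)` over the sphere. It
is `0` if the sphere is empty, the inverse of the measure being `0` then. -/
def profile (χ : AddChar K Circle) (r : ℝ) (t : K) : ℂ :=
  ((haar K).real (sphere K r) : ℂ)⁻¹ *
    fourier χ (fun x ξ : K => x * ξ) (sphereIndicator K r : K → ℂ) t

theorem profile_mem {χ : AddChar K Circle} (hχ : IsRankZero χ) (r : ℝ) : profile χ r ∈ bruhatSchwartz K :=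
  Submodule.smul_mem _ ((haar K).real (sphere K r) : ℂ)⁻¹
    (fourier_mem hχ (goodPairing_mul hχ) (sphereIndicator K r).2.1)

theorem profile_zero {χ : AddChar K Circle} (hχ : IsRankZero χ) {r : ℝ}
    (h : sphereIndicator K r ≠ 0) : profile χ r 0 = 1 := by
  rw [profile, fourier_zero (goodPairing_mul hχ), integral_sphereIndicator, inv_mul_cancel₀]
  exact Complex.ofReal_ne_zero.2 (haar_sphere_ne_zero h)

/-- The profiles are eigenfunctions of Vladimirov's operator, with value `1` at the origin. -/
theorem vladimirov_profile_zero (hK : IsNormalizedAbs K) {χ : AddChar K Circle}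
    (hχ : IsRankZero χ) {r : ℝ} (h : sphereIndicator K r ≠ 0) (γ : ℝ) (c : ℂ) :
    vladimirov χ γ (fun t => profile χ r t * c) 0 = ((r ^ γ : ℝ) : ℂ) * c := by
  set μ : ℂ := ((haar K).real (sphere K r) : ℂ) with hμ
  have hμ0 : μ ≠ 0 := Complex.ofReal_ne_zero.2 (haar_sphere_ne_zero h)
  have h1 : (fun t => profile χ r t * c) = (μ⁻¹ * c) •
      fourier χ (fun x ξ : K => x * ξ) (sphereIndicator K r : K → ℂ) := by
    ext t
    simp only [profile, Pi.smul_apply, smul_eq_mul]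
    ring
  have h2 : ∀ ξ : K, (sphereIndicator K r : K → ℂ) (-ξ) = (sphereIndicator K r : K → ℂ) ξ :=
    fun ξ => by
      classical
      simp [sphereIndicator, Set.indicator_apply, sphere]
  have h3 : ∀ ξ : K, ((‖ξ‖ ^ γ : ℝ) : ℂ) * ((μ⁻¹ * c) * (sphereIndicator K r : K → ℂ) ξ) =
      (((r ^ γ : ℝ) : ℂ) * (μ⁻¹ * c)) * (sphereIndicator K r : K → ℂ) ξ := fun ξ => by
    by_cases hξ : ξ ∈ sphere K r
    · rw [hξ.1]; ring
    · simp [sphereIndicator, hξ]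
  rw [vladimirov, fracDeriv, fourierInv_eq (goodPairing_mul hχ), neg_zero,
    fourier_zero (goodPairing_mul hχ), h1, fourier_smul]
  simp only [Pi.smul_apply, fourier_fourier hχ (selfDualPairing_mul hK hχ)
    (sphereIndicator K r).2.1, h2, smul_eq_mul, h3]
  rw [integral_const_mul, integral_sphereIndicator, ← hμ]
  field_simp

/-- The Fourier transform on `Φ(K)`. -/
def fourierK (hK : IsNormalizedAbs K) {χ : AddChar K Circle} (hχ : IsRankZero χ) :
    lizorkin K ≃ₗ[ℂ] vanishingAtZero K :=
  fourierEquiv hχ (selfDualPairing_mul hK hχ)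

/-- The Fourier transform on `Φ(Kⁿ)`. -/
def fourierKn (hK : IsNormalizedAbs K) {χ : AddChar K Circle} (hχ : IsRankZero χ) (n : ℕ) :
    lizorkin (Fin n → K) ≃ₗ[ℂ] vanishingAtZero (Fin n → K) :=
  fourierEquiv hχ (selfDualPairing_dot hK hχ n)

/-- The partial Fourier transform in `t` and `x` of a distribution, as a bilinear form. -/
def fourierDistribution (hK : IsNormalizedAbs K) {χ : AddChar K Circle} (hχ : IsRankZero χ)
    {n : ℕ} (F : VectorDistribution K n) :
    vanishingAtZero K →ₗ[ℂ] vanishingAtZero (Fin n → K) →ₗ[ℂ] ℂ :=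
  F.compl₁₂ (fourierK hK hχ).symm.toLinearMap (fourierKn hK hχ n).symm.toLinearMap

variable (hK : IsNormalizedAbs K) {χ : AddChar K Circle} (hχ : IsRankZero χ) {n : ℕ}

theorem fourierDistribution_apply (F : VectorDistribution K n) (g₁ : vanishingAtZero K)
    (g₂ : vanishingAtZero (Fin n → K)) : fourierDistribution hK hχ F g₁ g₂ =
      F ((fourierK hK hχ).symm g₁) ((fourierKn hK hχ n).symm g₂) := rfl

theorem lizorkinD_symm (α : ℝ) (g : vanishingAtZero K) :
    lizorkinD hχ α ((fourierK hK hχ).symm g) =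
      (fourierK hK hχ).symm (radialMul (fun r => ((r ^ α : ℝ) : ℂ)) g) := by
  ext x
  show fourierInv χ _ (fun ξ => ((‖ξ‖ ^ α : ℝ) : ℂ) *
    (fourierK hK hχ ((fourierK hK hχ).symm g) : K → ℂ) ξ) x = _
  rw [LinearEquiv.apply_symm_apply]
  rfl

theorem lizorkinDn_symm (α : ℝ) (g : vanishingAtZero (Fin n → K)) :
    lizorkinDn hχ α ((fourierKn hK hχ n).symm g) =
      (fourierKn hK hχ n).symm (radialMul (fun r => ((r ^ α : ℝ) : ℂ)) g) := by
  ext x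
  show fourierInv χ _ (fun ξ => ((‖ξ‖ ^ α : ℝ) : ℂ) *
    (fourierKn hK hχ n ((fourierKn hK hχ n).symm g) : (Fin n → K) → ℂ) ξ) x = _
  rw [LinearEquiv.apply_symm_apply]
  rfl

/-- The Fourier transform of a solution is supported on the cone `|τ| = ‖ξ‖`. -/
theorem fourierDistribution_shell_shell {α : ℝ} (hα : 0 < α) {F : VectorDistribution K n}
    (hF : IsGeneralizedSolution hχ α F) {r s : ℝ} (hrs : r ≠ s) (g₁ : vanishingAtZero K)
    (g₂ : vanishingAtZero (Fin n → K)) :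
    fourierDistribution hK hχ F (shell r g₁) (shell s g₂) = 0 := by
  rcases le_or_gt r 0 with hr | hr
  · rw [shell_of_nonpos hr, map_zero, LinearMap.zero_apply]
  rcases le_or_gt s 0 with hs | hs
  · rw [shell_of_nonpos hs, map_zero]
  have h := hF ((fourierK hK hχ).symm (shell r g₁)) ((fourierKn hK hχ n).symm (shell s g₂))
  rw [lizorkinD_symm hK hχ, lizorkinDn_symm hK hχ, radialMul_shell, radialMul_shell, map_smul,
    map_smul, map_smul, LinearMap.smul_apply, map_smul, ← fourierDistribution_apply, smul_eq_mul,
    smul_eq_mul] at h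
  have hne : ((r ^ α : ℝ) : ℂ) ≠ ((s ^ α : ℝ) : ℂ) := fun h' =>
    hrs ((Real.rpow_left_inj hr.le hs.le hα.ne').1 (Complex.ofReal_injective h'))
  rw [← sub_eq_zero, ← sub_mul] at h
  exact (mul_eq_zero.1 h).resolve_left (sub_ne_zero.2 hne)

theorem fourierDistribution_unitDilate {F : VectorDistribution K n} (hrad : IsRadial F) (ω : K)
    (hω : ‖ω‖ = 1) (g : vanishingAtZero K) :
    fourierDistribution hK hχ F (unitDilate ω hω g) = fourierDistribution hK hχ F g := by
  have hω' : ‖ω⁻¹‖ = 1 := by rw [norm_inv, hω, inv_one]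
  have h : (fourierK hK hχ).symm (unitDilate ω hω g) =
      dilate ω⁻¹ hω' ((fourierK hK hχ).symm g) := by
    ext x
    exact fourierInv_comp_mul_left χ hχ hω (bruhatSchwartz_continuous g.2.1) x
  ext g₂
  rw [fourierDistribution_apply, h, hrad, ← fourierDistribution_apply]

/-- The coefficient at the profile of radius `r` of the function representing `F`. -/
def coefficient (F : VectorDistribution K n) (r : ℝ) : vanishingAtZero (Fin n → K) →ₗ[ℂ] ℂ :=
  fourierDistribution hK hχ F (sphereIndicator K r) ∘ₗ shell r

theorem coefficient_finite (F : VectorDistribution K n) (g : vanishingAtZero (Fin n → K))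
    (u : ℝ → ℂ) : (Function.support fun r => u r * coefficient hK hχ F r g).Finite := by
  refine (shell_finite g).subset fun r hr h0 => hr ?_
  simp [coefficient, h0]

/-- The function representing a radial solution: the superposition of the profiles. -/
def representative (F : VectorDistribution K n) (t : K) : LizorkinDistribution (Fin n → K) where
  toFun φ := ∑ᶠ r, profile χ r t * coefficient hK hχ F r (fourierKn hK hχ n φ)
  map_add' φ ψ := by
    simp only [map_add, mul_add]
    exact finsum_add_distrib (coefficient_finite hK hχ F _ _) (coefficient_finite hK hχ F _ _)
  map_smul' c φ := by
    simp only [map_smul, smul_eq_mul, RingHom.id_apply]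
    refine (finsum_congr fun r => mul_left_comm _ c _).trans ?_
    exact (mul_finsum _ c).symm

theorem representative_eq_sum (F : VectorDistribution K n) (t : K) (φ : lizorkin (Fin n → K))
    {T : Finset ℝ} (hT : {r : ℝ | shell r (fourierKn hK hχ n φ) ≠ 0} ⊆ T) :
    representative hK hχ F t φ =
      ∑ r ∈ T, profile χ r t * coefficient hK hχ F r (fourierKn hK hχ n φ) := by
  refine finsum_eq_sum_of_support_subset _ fun r hr => hT fun h0 => hr ?_
  simp [coefficient, h0]

theorem representative_isTestFunction (F : VectorDistribution K n) :
    IsTestFunction (representative hK hχ F) := fun φ => by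
  have hfin := shell_finite (fourierKn hK hχ n φ)
  have h : (fun t => representative hK hχ F t φ) = ∑ r ∈ hfin.toFinset,
      coefficient hK hχ F r (fourierKn hK hχ n φ) • profile χ r := by
    ext t
    rw [representative_eq_sum hK hχ F t φ hfin.coe_toFinset.ge, Finset.sum_apply]
    exact Finset.sum_congr rfl fun r _ => mul_comm _ _
  rw [h]
  exact Submodule.sum_mem _ fun r _ => Submodule.smul_mem _ _ (profile_mem hχ r)

/-- On test functions that live on a single shell, the representative is a single profile. -/
theorem representative_symm_shell (F : VectorDistribution K n) (t : K) (r : ℝ)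
    (g : vanishingAtZero (Fin n → K)) :
    representative hK hχ F t ((fourierKn hK hχ n).symm (shell r g)) =
      profile χ r t * coefficient hK hχ F r g := by
  rw [representative_eq_sum hK hχ F t _ (T := {r}), Finset.sum_singleton,
    LinearEquiv.apply_symm_apply, coefficient, LinearMap.comp_apply, LinearMap.comp_apply,
    shell_shell, if_pos rfl]
  intro s hs
  rw [Set.mem_ofPred_eq, LinearEquiv.apply_symm_apply, shell_shell] at hs
  by_contra h
  exact hs (if_neg fun h' => h (by simpa using h'))

theorem representative_isGivenBy {α : ℝ} (hα : 0 < α) {F : VectorDistribution K n}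
    (hF : IsGeneralizedSolution hχ α F) (hrad : IsRadial F) :
    IsGivenBy F (representative hK hχ F) := fun φ₁ φ₂ => by
  classical
  obtain ⟨g₁, rfl⟩ := (fourierK hK hχ).symm.surjective φ₁
  obtain ⟨g₂, rfl⟩ := (fourierKn hK hχ n).symm.surjective φ₂
  set T : Finset ℝ := (shell_finite g₁).toFinset ∪ (shell_finite g₂).toFinset with hT
  have hT₁ : {r : ℝ | shell r g₁ ≠ 0} ⊆ T := fun r hr => by simp [hT]; exact Or.inl hr
  have hT₂ : {r : ℝ | shell r g₂ ≠ 0} ⊆ T := fun r hr => by simp [hT]; exact Or.inr hr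
  set φ : K → ℂ := ((fourierK hK hχ).symm g₁).1
  have hφm : φ ∈ bruhatSchwartz K := ((fourierK hK hχ).symm g₁).2.1
  have hφF : fourier χ (fun x ξ : K => x * ξ) φ = g₁ :=
    congrArg Subtype.val ((fourierK hK hχ).apply_symm_apply g₁)
  have hprof : ∀ r, ∫ t, profile χ r t * φ t ∂(haar K) =
      ((haar K).real (sphere K r) : ℂ)⁻¹ * ∫ ξ, (shell r g₁ : K → ℂ) ξ ∂(haar K) := fun r => by
    simp only [profile, mul_assoc]
    rw [integral_const_mul, ← integral_mul_fourier hχ (goodPairing_mul hχ) hφm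
      (sphereIndicator K r).2.1, hφF]
    simp only [sphereIndicator_mul]
  have hint : ∀ r, Integrable (fun t => profile χ r t * φ t) (haar K) := fun r =>
    ((bruhatSchwartz_continuous (profile_mem hχ r)).mul
      (bruhatSchwartz_continuous hφm)).integrable_of_hasCompactSupport hφm.2.mul_left
  have hcoef : ∀ r, (∫ t, profile χ r t * φ t ∂(haar K)) * coefficient hK hχ F r g₂ =
      fourierDistribution hK hχ F (shell r g₁) (shell r g₂) := fun r => by
    rw [map_shell (fourierDistribution_unitDilate hK hχ hrad) r g₁, hprof, LinearMap.smul_apply,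
      smul_eq_mul]
    rfl
  calc F ((fourierK hK hχ).symm g₁) ((fourierKn hK hχ n).symm g₂)
      = fourierDistribution hK hχ F (∑ r ∈ T, shell r g₁) (∑ s ∈ T, shell s g₂) := by
        rw [sum_shell hT₁, sum_shell hT₂]; rfl
    _ = ∑ r ∈ T, fourierDistribution hK hχ F (shell r g₁) (shell r g₂) := by
        rw [map_sum]
        refine Finset.sum_congr rfl fun s hs => ?_
        rw [map_sum, LinearMap.sum_apply]
        exact Finset.sum_eq_single_of_mem s hs fun r _ hr =>
          fourierDistribution_shell_shell hK hχ hα hF hr g₁ g₂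
    _ = ∑ r ∈ T, (∫ t, profile χ r t * φ t ∂(haar K)) * coefficient hK hχ F r g₂ :=
        Finset.sum_congr rfl fun r _ => (hcoef r).symm
    _ = ∫ t, ∑ r ∈ T, profile χ r t * φ t * coefficient hK hχ F r g₂ ∂(haar K) := by
        rw [integral_finsetSum _ fun r _ => (hint r).mul_const _]
        exact Finset.sum_congr rfl fun r _ => (integral_mul_const _ _).symm
    _ = ∫ t, representative hK hχ F t ((fourierKn hK hχ n).symm g₂) * φ t ∂(haar K) := by
        congr 1; ext t
        rw [representative_eq_sum hK hχ F t _ (T := T) (by rwa [LinearEquiv.apply_symm_apply]),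
          LinearEquiv.apply_symm_apply, Finset.sum_mul]
        exact Finset.sum_congr rfl fun r _ => mul_right_comm _ _ _

/-- Either kind of initial data determines the coefficients, hence the representative. -/
theorem representative_eq_of_initial_data {F G : VectorDistribution K n} (γ : ℝ)
    (h : representative hK hχ F 0 = representative hK hχ G 0 ∨
      ∀ φ : lizorkin (Fin n → K), vladimirov χ γ (fun t => representative hK hχ F t φ) 0 =
        vladimirov χ γ (fun t => representative hK hχ G t φ) 0) :
    representative hK hχ F = representative hK hχ G := by
  have hc : ∀ r g, coefficient hK hχ F r g = coefficient hK hχ G r g := fun r g => by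
    by_cases h0 : sphereIndicator K r = 0
    · simp [coefficient, h0]
    rcases h with h | h
    · have := LinearMap.congr_fun h ((fourierKn hK hχ n).symm (shell r g))
      simpa only [representative_symm_shell, profile_zero hχ h0, one_mul] using this
    · have := h ((fourierKn hK hχ n).symm (shell r g))
      simp only [representative_symm_shell, vladimirov_profile_zero hK hχ h0] at this
      refine mul_left_cancel₀ (Complex.ofReal_ne_zero.2 (Real.rpow_pos_of_pos ?_ γ).ne') this
      by_contra hr
      refine h0 ?_
      rw [← shell_sphereIndicator, shell_of_nonpos (not_lt.1 hr)]
  ext t φ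
  exact finsum_congr fun r => by rw [hc]

end Solution

section InitialData

variable {K : Type*} [NontriviallyNormedField K] [IsUltrametricDist K] [ProperSpace K]
  [MeasurableSpace K] [BorelSpace K]

/-- A radial solution is determined by its initial data; for the derivative of any order `γ`. -/
theorem eq_of_initial_data (hK : IsNormalizedAbs K) {χ : AddChar K Circle} (hχ : IsRankZero χ)
    {n : ℕ} {α : ℝ} (hα : 0 < α) {F G : VectorDistribution K n}
    (hF : IsGeneralizedSolution hχ α F) (hFr : IsRadial F)
    (hG : IsGeneralizedSolution hχ α G) (hGr : IsRadial G) (γ : ℝ)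
    {f g : K → LizorkinDistribution (Fin n → K)} (hf : IsTestFunction f) (hfF : IsGivenBy F f)
    (hg : IsTestFunction g) (hgG : IsGivenBy G g)
    (h : f 0 = g 0 ∨ ∀ φ : lizorkin (Fin n → K), vladimirov χ γ (fun t => f t φ) 0 =
      vladimirov χ γ (fun t => g t φ) 0) : F = G ∧ f = g := by
  have hf' := hfF.unique hf (representative_isTestFunction hK hχ F)
    (representative_isGivenBy hK hχ hα hF hFr)
  have hg' := hgG.unique hg (representative_isTestFunction hK hχ G)
    (representative_isGivenBy hK hχ hα hG hGr)
  have hfg : f = g := by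
    rw [hf', hg'] at h ⊢
    exact representative_eq_of_initial_data hK hχ γ h
  refine ⟨?_, hfg⟩
  ext φ₁ φ₂
  rw [hfF φ₁ φ₂, hgG φ₁ φ₂, hfg]

end InitialData

end LocalFieldWave

end
open LocalFieldWave in
theorem theorem2 {K : Type*} [NontriviallyNormedField K] [IsUltrametricDist K] [ProperSpace K]
    [MeasurableSpace K] [BorelSpace K] (hK : IsNormalizedAbs K)
    {χ : AddChar K Circle} (hχ : IsRankZero χ)
    (n : ℕ) (hn : 1 ≤ n) (α : ℝ) (hα : 0 < α)
    (F : VectorDistribution K n) (hF : IsGeneralizedSolution hχ α F) (hrad : IsRadial F) :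
    -- `F` belongs to `𝓓(K, Φ'(Kⁿ))`
    (∃! f : K → LizorkinDistribution (Fin n → K), IsTestFunction f ∧ IsGivenBy F f) ∧
    -- if `F(0, ·) = 0` or `(D_t ^ (n - 1) F)(0, ·) = 0`, then `F = 0`
    (∀ f : K → LizorkinDistribution (Fin n → K), IsTestFunction f → IsGivenBy F f →
      (f 0 = 0 ∨
        ∀ φ : lizorkin (Fin n → K), vladimirov χ ((n : ℝ) - 1) (fun t => f t φ) 0 = 0) →
      F = 0 ∧ f = 0) ∧
    -- a radial generalized solution is determined by its initial data
    (∀ G : VectorDistribution K n, IsGeneralizedSolution hχ α G → IsRadial G →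
      ∀ f g : K → LizorkinDistribution (Fin n → K),
        IsTestFunction f → IsGivenBy F f → IsTestFunction g → IsGivenBy G g →
        (f 0 = g 0 ∨
          ∀ φ : lizorkin (Fin n → K), vladimirov χ ((n : ℝ) - 1) (fun t => f t φ) 0 =
            vladimirov χ ((n : ℝ) - 1) (fun t => g t φ) 0) →
        F = G ∧ f = g) := by
  have key := fun G hG hGr f g hf hfF hg hgG h =>
    eq_of_initial_data hK hχ hα hF hrad (G := G) hG hGr ((n : ℝ) - 1) (f := f) (g := g)
      hf hfF hg hgG h
  refine ⟨⟨representative hK hχ F, ⟨representative_isTestFunction hK hχ F,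
    representative_isGivenBy hK hχ hα hF hrad⟩, fun f hf => hf.2.unique hf.1
      (representative_isTestFunction hK hχ F) (representative_isGivenBy hK hχ hα hF hrad)⟩,
    fun f hf hfF h => ?_, fun G hG hGr f g hf hfF hg hgG h => key G hG hGr f g hf hfF hg hgG h⟩
  refine key 0 (fun _ _ => rfl) (fun _ _ _ => rfl) f 0 hf hfF (fun _ => Submodule.zero_mem _)
    (fun _ _ => by simp) (h.imp id fun h φ => (h φ).trans ?_)
  simp [vladimirov, fracDeriv, LocalFieldWave.fourier, fourierInv]
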